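/- Let $T$ be the unilateral shift $Te_n=e_{n+1}$ on $\ell^2(\mathbb{Z}_+)$, let $\mathcal{T}$ be the Toeplitz algebra (the $C^*$-algebra generated by $T$), and put $T_{n,m}=T^n(T^*)^m$ for $n,m\ge 0$. Let $\Delta:\mathcal{T}\to\mathcal{T}\otimes\mathcal{T}$ (minimal tensor product) be the unique unital $*$-homomorphism with $\Delta(T)=T\otimes T$, and equip the dual space $\mathcal{T}^*$ with the product $(\rho*\varphi)(A)=(\rho\otimes\varphi)(\Delta(A))$. Let $\mathcal{K}^\perp\subset\mathcal{T}^*$ be the space of bounded functionals vanishing on the compact operators. For $V=\mathcal{T}^*$ or $V=\mathcal{K}^\perp$, a Haar functional in $V$ is a state $h\in V$ such that for every $\rho\in V$ there is $\lambda_\rho\in\mathbb{C}$ with $h*\rho=\rho*h=\lambda_\rho h$. Let $\gamma:\mathcal{T}\to C(S^1)$ be the unital $*$-homomorphism with $\gamma(T_{n,m})(e^{i\theta})=e^{i(m-n)\theta}$, and let $M(S^1)$ be the algebra of complex (regular) Borel measures on the circle with convolution. Then: 1. $\mathcal{K}^\perp$ is a subalgebra of $\mathcal{T}^*$, and the map sending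 $\mu\in M(S^1)$ to the functional $A\mapsto\int_{S^1}\gamma(A)\,d\mu$ is an algebra isomorphism of $M(S^1)$ onto $\mathcal{K}^\perp$. 2. There is exactly one Haar functional $h_0$ in $\mathcal{K}^\perp$, and $h_0(T_{n,m})=\delta_{n,m}$ for all $n,m\ge 0$. 3. There is exactly one Haar functional $h$ in $\mathcal{T}^*$, and $h_0\neq h$. 4. Under the isomorphism in 1, $h_0$ is the image of the normalized Haar (Lebesgue) measure on $S^1$. -/

import Mathlib

open scoped TensorProduct ComplexOrder ComplexConjugate

namespace ToeplitzQS

noncomputable section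

/-- The Hilbert space `ℓ²(ℤ₊)`. -/
abbrev Ell2 : Type := lp (fun _ : ℕ => ℂ) 2

/-- The standard basis vector `e_n`. -/
def stdBasis (n : ℕ) : Ell2 := lp.single 2 n (1 : ℂ)

/-- Shifting a sequence to the right. -/
def shiftFun (f : ℕ → ℂ) : ℕ → ℂ
  | 0 => 0
  | n + 1 => f n

lemma memlp_shiftFun (f : Ell2) : Memℓp (shiftFun f) 2 := by
  have h := lp.memℓp f
  rw [memℓp_gen_iff (by norm_num)] at h ⊢
  rw [← summable_nat_add_iff 1]
  simpa [shiftFun] using h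

/-- The unilateral right shift, as a linear isometry of `ℓ²(ℤ₊)`. -/
def shiftIsometry : Ell2 →ₗᵢ[ℂ] Ell2 where
  toFun f := ⟨shiftFun f, memlp_shiftFun f⟩
  map_add' f g := by
    ext n
    cases n
    · exact (add_zero (0 : ℂ)).symm
    · rfl
  map_smul' c f := by
    ext n
    cases n
    · exact (mul_zero c).symm
    · rfl
  norm_map' f := by
    have hs : Summable fun i => ‖shiftFun f i‖ ^ (2 : ENNReal).toReal :=
      (memlp_shiftFun f).summable (by norm_num)
    simp only [lp.norm_eq_tsum_rpow (p := 2) (by norm_num)]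
    congr 1
    change ∑' i, ‖shiftFun f i‖ ^ (2 : ENNReal).toReal = _
    rw [hs.tsum_eq_zero_add]
    simp [shiftFun]

/-- The right shift operator `T`, a bounded operator on `ℓ²(ℤ₊)`. -/
def shift : Ell2 →L[ℂ] Ell2 := shiftIsometry.toContinuousLinearMap

lemma shift_stdBasis (n : ℕ) : shift (stdBasis n) = stdBasis (n + 1) := by
  ext k
  change shiftFun (stdBasis n) k = _
  cases k with
  | zero => simp [shiftFun, stdBasis]
  | succ k => simp [shiftFun, stdBasis, Pi.single_apply]

lemma star_shift_mul_shift : star shift * shift = 1 := by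
  rw [ContinuousLinearMap.star_eq_adjoint]
  exact (ContinuousLinearMap.norm_map_iff_adjoint_comp_self shift).1 shiftIsometry.norm_map

/-- The Toeplitz algebra `𝒯`: the norm closed unital `*`-subalgebra of `B(ℓ²(ℤ₊))` generated by
the shift `T` (equivalently, the closed subalgebra generated by `T` and `T*`, as `T* T = 1`). -/
abbrev toeplitz : StarSubalgebra ℂ (Ell2 →L[ℂ] Ell2) := StarAlgebra.elemental ℂ shift

/-! Shortcuts for instance search. -/

instance : Ring toeplitz := inferInstance

instance : Semiring toeplitz := inferInstance

instance : Monoid toeplitz := inferInstance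

instance : AddCommMonoid toeplitz := inferInstance

instance : Algebra ℂ toeplitz := inferInstance

instance : NormedSpace ℂ toeplitz := inferInstance

instance : Module ℂ toeplitz := inferInstance

/-- The shift as an element of the Toeplitz algebra. -/
def toeplitzShift : toeplitz := ⟨shift, StarAlgebra.elemental.self_mem ℂ shift⟩

/-- The elements `T_{n,m} = Tⁿ (T*)ᵐ` of the Toeplitz algebra. -/
def monomial (n m : ℕ) : toeplitz := toeplitzShift ^ n * star toeplitzShift ^ m

/-- Two continuous unital `*`-homomorphisms on the Toeplitz algebra agree if they agree at the
shift. -/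
lemma starAlgHom_ext {B : Type*} [CStarAlgebra B] (f g : toeplitz →⋆ₐ[ℂ] B)
    (h : f toeplitzShift = g toeplitzShift) : f = g := by
  have hc (f : toeplitz →⋆ₐ[ℂ] B) : Continuous f :=
    AddMonoidHomClass.continuous_of_bound f 1 fun x => by
      simpa using NonUnitalStarAlgHom.norm_apply_le f x
  exact StarAlgebra.elemental.starAlgHomClass_ext ℂ (hc f) (hc g) h

/-! ### The symbol map -/

/-- The unit vectors `x_N = (N+1)^{-1/2} ∑_{j ≤ N} z^j e_j`, which are asymptotic
eigenvectors of `T` for the eigenvalue `z⁻¹`. -/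
def approxVec (z : Circle) (N : ℕ) : Ell2 :=
  ((Real.sqrt (N + 1) : ℝ) : ℂ)⁻¹ • ∑ j ∈ Finset.range (N + 1), ((z : ℂ) ^ j) • stdBasis j

lemma orthonormal_stdBasis : Orthonormal ℂ stdBasis := by
  classical
  rw [orthonormal_iff_ite]
  intro i j
  simp [stdBasis, lp.inner_single_left, Pi.single_apply]

lemma norm_approxVec (z : Circle) (N : ℕ) : ‖approxVec z N‖ = 1 := by
  have h0 : (0 : ℝ) < N + 1 := by positivity
  have h : ‖∑ j ∈ Finset.range (N + 1), ((z : ℂ) ^ j) • stdBasis j‖ ^ 2 = N + 1 := by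
    rw [← inner_self_eq_norm_sq (𝕜 := ℂ), orthonormal_stdBasis.inner_sum]
    have h1 (j : ℕ) : conj ((z : ℂ) ^ j) * (z : ℂ) ^ j = 1 := by
      rw [Complex.conj_mul', norm_pow, Circle.norm_coe]
      simp
    simp_rw [h1]
    simp
  have h' : ‖∑ j ∈ Finset.range (N + 1), ((z : ℂ) ^ j) • stdBasis j‖ = Real.sqrt (N + 1) := by
    rw [← h, Real.sqrt_sq (norm_nonneg _)]
  rw [approxVec, norm_smul, h', norm_inv, Complex.norm_real, Real.norm_of_nonneg (by positivity)]
  exact inv_mul_cancel₀ (by positivity)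

lemma tendsto_shift_approxVec (z : Circle) :
    Filter.Tendsto (fun N => shift (approxVec z N) - conj (z : ℂ) • approxVec z N)
      Filter.atTop (nhds 0) := by
  have key (N : ℕ) : shift (approxVec z N) - conj (z : ℂ) • approxVec z N =
      ((Real.sqrt (N + 1) : ℝ) : ℂ)⁻¹ •
        ((z : ℂ) ^ N • stdBasis (N + 1) - conj (z : ℂ) • stdBasis 0) := by
    have hz : conj (z : ℂ) * z = 1 := by simp [Complex.conj_mul', Circle.norm_coe]
    rw [approxVec, map_smul, smul_comm (conj (z : ℂ)), ← smul_sub, map_sum]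
    congr 1
    rw [Finset.smul_sum, Finset.sum_range_succ, Finset.sum_range_succ']
    have : ∑ j ∈ Finset.range N, conj (z : ℂ) • ((z : ℂ) ^ (j + 1) • stdBasis (j + 1)) =
        ∑ j ∈ Finset.range N, shift ((z : ℂ) ^ j • stdBasis j) := by
      refine Finset.sum_congr rfl fun j _ => ?_
      rw [map_smul, shift_stdBasis, smul_smul, pow_succ', ← mul_assoc, hz, one_mul]
    rw [this, map_smul, shift_stdBasis]
    simp
  simp_rw [key]
  rw [tendsto_zero_iff_norm_tendsto_zero]
  have hlim : Filter.Tendsto (fun N : ℕ => (Real.sqrt ((N : ℝ) + 1))⁻¹ * 2)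
      Filter.atTop (nhds 0) := by
    rw [show (0 : ℝ) = 0 * 2 by simp]
    refine Filter.Tendsto.mul_const _ (Filter.Tendsto.inv_tendsto_atTop ?_)
    exact Real.tendsto_sqrt_atTop.comp
      (Filter.tendsto_atTop_add_const_right _ _ tendsto_natCast_atTop_atTop)
  refine squeeze_zero (fun _ => norm_nonneg _) (fun N => ?_) hlim
  rw [norm_smul, norm_inv, Complex.norm_real, Real.norm_of_nonneg (by positivity)]
  gcongr
  refine (norm_sub_le _ _).trans ?_
  rw [norm_smul, norm_smul, orthonormal_stdBasis.1, orthonormal_stdBasis.1]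
  simp [Circle.norm_coe]
  norm_num

lemma tendsto_star_shift_approxVec (z : Circle) :
    Filter.Tendsto (fun N => star shift (approxVec z N) - (z : ℂ) • approxVec z N)
      Filter.atTop (nhds 0) := by
  have hz : (z : ℂ) * conj (z : ℂ) = 1 := by simp [Complex.mul_conj', Circle.norm_coe]
  have h1 (x : Ell2) : star shift (shift x) = x :=
    DFunLike.congr_fun star_shift_mul_shift x
  have h := (((star shift).continuous.tendsto 0).comp (tendsto_shift_approxVec z)).const_smul
    (-(z : ℂ))
  simp only [map_zero, smul_zero] at h
  refine h.congr fun N => ?_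
  simp only [Function.comp, map_sub, map_smul, h1, smul_sub, smul_smul]
  rw [neg_mul, hz]
  simp [sub_eq_add_neg, add_comm]

/-- Pairs `(A, f)` such that `A x_N - f(z) x_N → 0` and `A* x_N - conj f(z) x_N → 0`
for all `z` in the circle. -/
def symbolGraph : StarSubalgebra ℂ ((Ell2 →L[ℂ] Ell2) × C(Circle, ℂ)) where
  carrier := {p | ∀ z : Circle,
    Filter.Tendsto (fun N => p.1 (approxVec z N) - p.2 z • approxVec z N)
      Filter.atTop (nhds 0) ∧
    Filter.Tendsto (fun N => star p.1 (approxVec z N) - conj (p.2 z) • approxVec z N)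
      Filter.atTop (nhds 0)}
  mul_mem' {p q} hp hq z := by
    constructor
    · have h := ((p.1.continuous.tendsto 0).comp (hq z).1).add ((hp z).1.const_smul (q.2 z))
      simp only [map_zero, smul_zero, add_zero] at h
      refine h.congr fun N => ?_
      simp [smul_sub, smul_smul, mul_comm]
    · have h := (((star q.1).continuous.tendsto 0).comp (hp z).2).add
        ((hq z).2.const_smul (conj (p.2 z)))
      simp only [map_zero, smul_zero, add_zero] at h
      refine h.congr fun N => ?_
      simp [smul_sub, smul_smul]
  add_mem' {p q} hp hq z := by
    constructor
    · have h := (hp z).1.add (hq z).1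
      rw [add_zero] at h
      refine h.congr fun N => ?_
      simp only [Prod.fst_add, Prod.snd_add, ContinuousMap.add_apply, add_smul,
        add_apply]
      abel
    · have h := (hp z).2.add (hq z).2
      rw [add_zero] at h
      refine h.congr fun N => ?_
      simp only [Prod.fst_add, Prod.snd_add, ContinuousMap.add_apply, add_smul, star_add, map_add,
        add_apply]
      abel
  algebraMap_mem' c z := by
    constructor
    · simp [Algebra.algebraMap_eq_smul_one]
    · simp [Algebra.algebraMap_eq_smul_one]
  star_mem' {p} hp z := by
    refine ⟨?_, ?_⟩
    · simpa using (hp z).2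
    · simpa using (hp z).1

lemma mem_symbolGraph {p : (Ell2 →L[ℂ] Ell2) × C(Circle, ℂ)} :
    p ∈ symbolGraph ↔ ∀ z : Circle,
    Filter.Tendsto (fun N => p.1 (approxVec z N) - p.2 z • approxVec z N)
      Filter.atTop (nhds 0) ∧
    Filter.Tendsto (fun N => star p.1 (approxVec z N) - conj (p.2 z) • approxVec z N)
      Filter.atTop (nhds 0) := Iff.rfl

lemma norm_symbol_le {p : (Ell2 →L[ℂ] Ell2) × C(Circle, ℂ)} (hp : p ∈ symbolGraph) :
    ‖p.2‖ ≤ ‖p.1‖ := by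
  rw [ContinuousMap.norm_le _ (norm_nonneg _)]
  intro z
  have h := ((hp z).1.norm).const_add ‖p.1‖
  rw [norm_zero, add_zero] at h
  refine ge_of_tendsto' h fun N => ?_
  have h1 : ‖p.2 z • approxVec z N‖ = ‖p.2 z‖ := by rw [norm_smul, norm_approxVec, mul_one]
  have h2 : ‖p.1 (approxVec z N)‖ ≤ ‖p.1‖ := by
    simpa [norm_approxVec] using p.1.le_opNorm (approxVec z N)
  rw [← h1]
  calc _ = ‖p.1 (approxVec z N) - (p.1 (approxVec z N) - p.2 z • approxVec z N)‖ := by simp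
    _ ≤ _ := (norm_sub_le _ _).trans (by gcongr)

lemma isClosed_symbolGraph : IsClosed (symbolGraph : Set ((Ell2 →L[ℂ] Ell2) × C(Circle, ℂ))) := by
  have aux (z : Circle) (q : ℕ → (Ell2 →L[ℂ] Ell2) × ℂ) (p : (Ell2 →L[ℂ] Ell2) × ℂ)
      (hq : Filter.Tendsto q Filter.atTop (nhds p))
      (h : ∀ k, Filter.Tendsto (fun N => (q k).1 (approxVec z N) - (q k).2 • approxVec z N)
        Filter.atTop (nhds 0)) :
      Filter.Tendsto (fun N => p.1 (approxVec z N) - p.2 • approxVec z N)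
        Filter.atTop (nhds 0) := by
    rw [Metric.tendsto_atTop] at hq ⊢
    intro ε hε
    obtain ⟨k, hk⟩ := hq (ε / 3) (by positivity)
    specialize hk k le_rfl
    obtain ⟨M, hM⟩ := (Metric.tendsto_atTop.1 (h k)) (ε / 3) (by positivity)
    refine ⟨M, fun N hN => ?_⟩
    specialize hM N hN
    rw [dist_zero_right] at hM ⊢
    rw [dist_comm, dist_eq_norm] at hk
    have h1 : ‖(p.1 - (q k).1) (approxVec z N)‖ ≤ ‖p.1 - (q k).1‖ := by
      simpa [norm_approxVec] using (p.1 - (q k).1).le_opNorm (approxVec z N)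
    have h2 : ‖(p.2 - (q k).2) • approxVec z N‖ = ‖p.2 - (q k).2‖ := by
      rw [norm_smul, norm_approxVec, mul_one]
    have h3 : ‖p.1 - (q k).1‖ ≤ ‖p - q k‖ := norm_fst_le (p - q k)
    have h4 : ‖p.2 - (q k).2‖ ≤ ‖p - q k‖ := norm_snd_le (p - q k)
    have h5 : p.1 (approxVec z N) - p.2 • approxVec z N =
        (p.1 - (q k).1) (approxVec z N) - (p.2 - (q k).2) • approxVec z N +
        ((q k).1 (approxVec z N) - (q k).2 • approxVec z N) := by
      simp only [sub_apply, sub_smul]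
      abel
    rw [h5]
    refine (norm_add_le _ _).trans_lt ?_
    have := norm_sub_le ((p.1 - (q k).1) (approxVec z N)) ((p.2 - (q k).2) • approxVec z N)
    linarith
  refine IsSeqClosed.isClosed fun q p hq hp z => ⟨?_, ?_⟩
  · refine aux z (fun k => ((q k).1, (q k).2 z)) (p.1, p.2 z) ?_ (fun k => (hq k z).1)
    exact (((continuous_fst.prodMk
      ((continuous_eval_const z).comp continuous_snd)).tendsto p).comp hp)
  · refine aux z (fun k => (star (q k).1, conj ((q k).2 z))) (star p.1, conj (p.2 z)) ?_
      (fun k => (hq k z).2)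
    exact ((((continuous_star.comp continuous_fst).prodMk
      (Complex.continuous_conj.comp
        ((continuous_eval_const z).comp continuous_snd))).tendsto p).comp hp)

/-- The continuous function `z ↦ z` on the circle. -/
def circleVar : C(Circle, ℂ) := ⟨fun z => z, by fun_prop⟩

@[simp] lemma circleVar_apply (z : Circle) : circleVar z = z := rfl

/-- There is a unique unital `*`-homomorphism `γ : 𝒯 → C(S¹)` with `γ(T) = e^{-iθ}`. -/
lemma existsUnique_symbol :
    ∃! γ : toeplitz →⋆ₐ[ℂ] C(Circle, ℂ), γ toeplitzShift = star circleVar := by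
  let π : symbolGraph →⋆ₐ[ℂ] (Ell2 →L[ℂ] Ell2) :=
    (StarAlgHom.fst ℂ (Ell2 →L[ℂ] Ell2) C(Circle, ℂ)).comp symbolGraph.subtype
  have hπ : Isometry π := by
    refine AddMonoidHomClass.isometry_of_norm π fun p => ?_
    change ‖p.1.1‖ = ‖p.1‖
    rw [Prod.norm_def, max_eq_left (norm_symbol_le p.2)]
  have : CompleteSpace symbolGraph := isClosed_symbolGraph.completeSpace_coe
  have hmem : ((shift, star circleVar) : (Ell2 →L[ℂ] Ell2) × C(Circle, ℂ)) ∈ symbolGraph := by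
    intro z
    exact ⟨tendsto_shift_approxVec z, by simpa using tendsto_star_shift_approxVec z⟩
  have hle : toeplitz ≤ π.range := by
    refine StarAlgebra.elemental.le_of_mem ?_ ⟨⟨_, hmem⟩, rfl⟩
    exact hπ.isClosedEmbedding.isClosed_range
  let E := StarAlgEquiv.ofInjective π hπ.injective
  let γ : toeplitz →⋆ₐ[ℂ] C(Circle, ℂ) :=
    (StarAlgHom.snd ℂ (Ell2 →L[ℂ] Ell2) C(Circle, ℂ)).comp (symbolGraph.subtype.comp
      ((E.symm : π.range →⋆ₐ[ℂ] symbolGraph).comp (StarSubalgebra.inclusion hle)))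
  have h0 : γ toeplitzShift = star circleVar := by
    have : E.symm (StarSubalgebra.inclusion hle toeplitzShift) = ⟨_, hmem⟩ := by
      rw [StarAlgEquiv.symm_apply_eq]
      rfl
    change (E.symm (StarSubalgebra.inclusion hle toeplitzShift)).1.2 = _
    rw [this]
  refine ⟨γ, h0, ?_⟩
  · intro g hg
    exact starAlgHom_ext _ _ (hg.trans h0.symm)

/-! ### Tensor products of operators and functionals -/

/-- The Hilbert space tensor product: the completion of the algebraic tensor product. -/
def HTensor (E F : Type*) [NormedAddCommGroup E] [InnerProductSpace ℂ E]
    [NormedAddCommGroup F] [InnerProductSpace ℂ F] : Type _ :=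
  UniformSpace.Completion (E ⊗[ℂ] F)

section tensor

variable {E F : Type*} [NormedAddCommGroup E] [InnerProductSpace ℂ E]
  [NormedAddCommGroup F] [InnerProductSpace ℂ F]

instance : NormedAddCommGroup (HTensor E F) :=
  inferInstanceAs (NormedAddCommGroup (UniformSpace.Completion (E ⊗[ℂ] F)))

instance : InnerProductSpace ℂ (HTensor E F) :=
  inferInstanceAs (InnerProductSpace ℂ (UniformSpace.Completion (E ⊗[ℂ] F)))

instance : CompleteSpace (HTensor E F) :=
  inferInstanceAs (CompleteSpace (UniformSpace.Completion (E ⊗[ℂ] F)))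

/-- The vector `x ⊗ y` of the Hilbert space tensor product, bilinear and continuous. -/
def vecTensor : E →L[ℂ] F →L[ℂ] HTensor E F :=
  (ContinuousLinearMap.compL ℂ F (E ⊗[ℂ] F) (HTensor E F)
    (UniformSpace.Completion.toComplL : E ⊗[ℂ] F →L[ℂ] UniformSpace.Completion (E ⊗[ℂ] F))).comp
    (TensorProduct.mkL ℂ E F)

lemma vecTensor_apply (x : E) (y : F) :
    vecTensor x y = ((x ⊗ₜ[ℂ] y : E ⊗[ℂ] F) : UniformSpace.Completion (E ⊗[ℂ] F)) := rfl

/-- The operator `A ⊗ B` on the Hilbert space tensor product. -/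
def opTensor (A : E →L[ℂ] E) (B : F →L[ℂ] F) : HTensor E F →L[ℂ] HTensor E F :=
  (TensorProduct.mapL A B).completion

lemma opTensor_vecTensor (A : E →L[ℂ] E) (B : F →L[ℂ] F) (x : E) (y : F) :
    opTensor A B (vecTensor x y) = vecTensor (A x) (B y) := by
  exact (ContinuousLinearMap.completion_apply_coe _ _).trans rfl

lemma inner_vecTensor (x x' : E) (y y' : F) :
    inner ℂ (vecTensor x y) (vecTensor x' y') = inner ℂ x x' * inner ℂ y y' := by
  exact (UniformSpace.Completion.inner_coe _ _).trans (TensorProduct.inner_tmul _ _ _ _ _)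

lemma norm_vecTensor (x : E) (y : F) : ‖vecTensor x y‖ = ‖x‖ * ‖y‖ := by
  exact (UniformSpace.Completion.norm_coe _).trans (TensorProduct.norm_tmul _ _)

/-- A closed subspace containing all `x ⊗ y` is everything. -/
lemma eq_top_of_vecTensor_mem (M : Submodule ℂ (HTensor E F))
    (hM : IsClosed (M : Set (HTensor E F))) (h : ∀ x y, vecTensor x y ∈ M) : M = ⊤ := by
  refine Submodule.eq_top_iff'.2 fun v => ?_
  induction v using UniformSpace.Completion.induction_on with
  | hp => exact hM
  | ih t =>
    induction t using TensorProduct.induction_on with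
    | zero => exact M.zero_mem
    | tmul x y => exact h x y
    | add a b ha hb =>
      rw [UniformSpace.Completion.coe_add]
      exact M.add_mem (x := (a : UniformSpace.Completion (E ⊗[ℂ] F))) ha hb

/-- A closed subspace containing all `u_i ⊗ v_j`, for total families `u` and `v`, is everything. -/
lemma eq_top_of_total {ι κ : Type*} {u : ι → E} {v : κ → F}
    (hu : (Submodule.span ℂ (Set.range u)).topologicalClosure = ⊤)
    (hv : (Submodule.span ℂ (Set.range v)).topologicalClosure = ⊤)
    (M : Submodule ℂ (HTensor E F)) (hM : IsClosed (M : Set (HTensor E F)))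
    (h : ∀ i j, vecTensor (u i) (v j) ∈ M) : M = ⊤ := by
  have h1 (x : E) (j : κ) : vecTensor x (v j) ∈ M := by
    have : (Submodule.span ℂ (Set.range u)).topologicalClosure ≤
        M.comap ((vecTensor : E →L[ℂ] F →L[ℂ] HTensor E F).flip (v j)).toLinearMap := by
      refine Submodule.topologicalClosure_minimal _ (Submodule.span_le.2 ?_)
        (hM.preimage (ContinuousLinearMap.continuous _))
      rintro _ ⟨i, rfl⟩
      exact h i j
    exact (this.trans' hu.ge) (Submodule.mem_top (x := x))
  refine eq_top_of_vecTensor_mem M hM fun x y => ?_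
  have : (Submodule.span ℂ (Set.range v)).topologicalClosure ≤
      M.comap ((vecTensor : E →L[ℂ] F →L[ℂ] HTensor E F) x).toLinearMap := by
    refine Submodule.topologicalClosure_minimal _ (Submodule.span_le.2 ?_)
      (hM.preimage (ContinuousLinearMap.continuous _))
    rintro _ ⟨j, rfl⟩
    exact h1 x j
  exact (this.trans' hv.ge) (Submodule.mem_top (x := y))

lemma clm_ext_vecTensor {G : Type*} [NormedAddCommGroup G] [NormedSpace ℂ G]
    {f g : HTensor E F →L[ℂ] G} (h : ∀ x y, f (vecTensor x y) = g (vecTensor x y)) : f = g := by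
  have := eq_top_of_vecTensor_mem (LinearMap.eqLocus f.toLinearMap g.toLinearMap)
    (isClosed_eq f.continuous g.continuous) h
  ext v
  exact (this.ge (Submodule.mem_top (x := v)) :)

lemma opTensor_one_one : opTensor (1 : E →L[ℂ] E) (1 : F →L[ℂ] F) = 1 :=
  clm_ext_vecTensor fun x y => by simp [opTensor_vecTensor]

lemma opTensor_mul (A A' : E →L[ℂ] E) (B B' : F →L[ℂ] F) :
    opTensor A B * opTensor A' B' = opTensor (A * A') (B * B') :=
  clm_ext_vecTensor fun x y => by simp [opTensor_vecTensor]

lemma star_opTensor [CompleteSpace E] [CompleteSpace F] (A : E →L[ℂ] E) (B : F →L[ℂ] F) :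
    star (opTensor A B) = opTensor (star A) (star B) := by
  refine clm_ext_vecTensor fun x y => ?_
  have : (⊤ : Submodule ℂ (HTensor E F)) ≤ LinearMap.ker
      (innerSL ℂ (star (opTensor A B) (vecTensor x y) -
        opTensor (star A) (star B) (vecTensor x y))).toLinearMap := by
    refine (eq_top_of_vecTensor_mem _ (ContinuousLinearMap.isClosed_ker _) fun x' y' => ?_).ge
    simp [ContinuousLinearMap.star_eq_adjoint, ContinuousLinearMap.adjoint_inner_left, opTensor_vecTensor, inner_vecTensor]
  rw [← sub_eq_zero, ← inner_self_eq_zero (𝕜 := ℂ)]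
  exact this Submodule.mem_top

lemma opTensor_add_left (A A' : E →L[ℂ] E) (B : F →L[ℂ] F) :
    opTensor (A + A') B = opTensor A B + opTensor A' B :=
  clm_ext_vecTensor fun x y => by simp [opTensor_vecTensor]

lemma opTensor_smul_left (c : ℂ) (A : E →L[ℂ] E) (B : F →L[ℂ] F) :
    opTensor (c • A) B = c • opTensor A B :=
  clm_ext_vecTensor fun x y => by simp [opTensor_vecTensor]

/-- The amplification `A ↦ A ⊗ 1`. -/
def amplification [CompleteSpace E] [CompleteSpace F] :
    (E →L[ℂ] E) →⋆ₐ[ℂ] (HTensor E F →L[ℂ] HTensor E F) where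
  toFun A := opTensor A 1
  map_one' := opTensor_one_one
  map_mul' A B := by rw [opTensor_mul, one_mul]
  map_zero' := by simpa using opTensor_smul_left (0 : ℂ) (0 : E →L[ℂ] E) (1 : F →L[ℂ] F)
  map_add' A B := opTensor_add_left A B 1
  commutes' c := by
    rw [Algebra.algebraMap_eq_smul_one, opTensor_smul_left, opTensor_one_one,
      Algebra.algebraMap_eq_smul_one]
  map_star' A := by rw [star_opTensor, star_one]

/-- Bounded functionals `ρ`, `φ` on `B(E)`, `B(F)` have a bounded tensor product on `B(E ⊗ F)`. -/
lemma exists_functional_tensor [CompleteSpace E] [CompleteSpace F]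
    (ρ : StrongDual ℂ (E →L[ℂ] E)) (φ : StrongDual ℂ (F →L[ℂ] F)) :
    ∃ Φ : StrongDual ℂ (HTensor E F →L[ℂ] HTensor E F),
      ∀ A B, Φ (opTensor A B) = ρ A * φ B := by
  let V : F →L[ℂ] E →L[ℂ] HTensor E F := (vecTensor : E →L[ℂ] F →L[ℂ] HTensor E F).flip
  have hV (y : F) : ‖V y‖ ≤ ‖y‖ :=
    ContinuousLinearMap.opNorm_le_bound _ (norm_nonneg _) fun x => by
      change ‖vecTensor x y‖ ≤ _
      rw [norm_vecTensor, mul_comm]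
  have hbd (U : HTensor E F →L[ℂ] HTensor E F) (η ξ : F) :
      ‖ρ ((V η).adjoint ∘L U ∘L V ξ)‖ ≤ ‖ρ‖ * ‖U‖ * ‖η‖ * ‖ξ‖ := by
    refine (ρ.le_opNorm _).trans ?_
    rw [mul_assoc, mul_assoc]
    gcongr
    refine (ContinuousLinearMap.opNorm_comp_le _ _).trans ?_
    rw [LinearIsometryEquiv.norm_map]
    calc ‖V η‖ * ‖U ∘L V ξ‖ ≤ ‖η‖ * (‖U‖ * ‖ξ‖) := by
          gcongr
          · exact hV η
          · exact (ContinuousLinearMap.opNorm_comp_le _ _).trans (by gcongr; exact hV ξ)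
      _ = _ := by ring
  let Q (U : HTensor E F →L[ℂ] HTensor E F) : F →L⋆[ℂ] F →L[ℂ] ℂ :=
    LinearMap.mkContinuous₂
      (LinearMap.mk₂'ₛₗ (starRingEnd ℂ) (RingHom.id ℂ)
        (fun η ξ => ρ ((V η).adjoint ∘L U ∘L V ξ))
        (fun η η' ξ => by simp)
        (fun c η ξ => by
          rw [map_smul, map_smulₛₗ, ContinuousLinearMap.smul_comp, map_smul])
        (fun η ξ ξ' => by simp)
        (fun c η ξ => by simp))
      (‖ρ‖ * ‖U‖) (hbd U)
  let S (U : HTensor E F →L[ℂ] HTensor E F) : F →L[ℂ] F :=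
    (InnerProductSpace.continuousLinearMapOfBilin (Q U)).adjoint
  have hS (U : HTensor E F →L[ℂ] HTensor E F) (η ξ : F) :
      inner ℂ η (S U ξ) = ρ ((V η).adjoint ∘L U ∘L V ξ) := by
    rw [ContinuousLinearMap.adjoint_inner_right,
      InnerProductSpace.continuousLinearMapOfBilin_apply]
    rfl
  have hSn (U : HTensor E F →L[ℂ] HTensor E F) : ‖S U‖ ≤ ‖ρ‖ * ‖U‖ := by
    refine ContinuousLinearMap.opNorm_le_bound _ (by positivity) fun ξ => ?_
    have h := hbd U (S U ξ) ξ
    rw [← hS, inner_self_eq_norm_sq_to_K, norm_pow, RCLike.norm_ofReal, abs_norm, sq,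
      mul_right_comm] at h
    rcases (norm_nonneg (S U ξ)).eq_or_lt with h0 | h0
    · rw [← h0]
      positivity
    · exact le_of_mul_le_mul_right h h0
  let L : (HTensor E F →L[ℂ] HTensor E F) →ₗ[ℂ] ℂ :=
    { toFun := fun U => φ (S U)
      map_add' := fun U U' => by
        rw [← map_add]
        congr 1
        ext1 ξ
        refine ext_inner_left ℂ fun η => ?_
        simp [hS, inner_add_right]
      map_smul' := fun c U => by
        rw [RingHom.id_apply, ← map_smul]
        congr 1
        ext1 ξ
        refine ext_inner_left ℂ fun η => ?_
        simp [hS, inner_smul_right] }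
  have hL (U : HTensor E F →L[ℂ] HTensor E F) : ‖L U‖ ≤ ‖φ‖ * ‖ρ‖ * ‖U‖ := by
    refine (φ.le_opNorm _).trans ?_
    rw [mul_assoc]
    gcongr
    exact hSn U
  let Φ : StrongDual ℂ (HTensor E F →L[ℂ] HTensor E F) := L.mkContinuous (‖φ‖ * ‖ρ‖) hL
  refine ⟨Φ, fun A B => ?_⟩
  · change φ (S (opTensor A B)) = _
    have : S (opTensor A B) = ρ A • B := by
      ext1 ξ
      refine ext_inner_left ℂ fun η => ?_
      have h2 : (V η).adjoint ∘L opTensor A B ∘L V ξ = inner ℂ η (B ξ) • A := by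
        ext1 x
        refine ext_inner_left ℂ fun x' => ?_
        have h3 (x : E) (y : F) : V y x = vecTensor x y := rfl
        simp [ContinuousLinearMap.adjoint_inner_right, h3, opTensor_vecTensor, inner_vecTensor,
          inner_smul_right, mul_comm]
      rw [hS, h2]
      simp [inner_smul_right, mul_comm]
    rw [this]
    simp

end tensor

/-! ### The comultiplication -/

/-- The minimal tensor product `𝒯 ⊗ 𝒯`: the norm closure, inside the bounded operators on
`ℓ²(ℤ₊) ⊗ ℓ²(ℤ₊)`, of the `*`-algebra generated by the operators `a ⊗ b` with `a, b ∈ 𝒯`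
(which is the linear span of these operators). -/
abbrev minTensor : StarSubalgebra ℂ (HTensor Ell2 Ell2 →L[ℂ] HTensor Ell2 Ell2) :=
  (StarAlgebra.adjoin ℂ (Set.range fun p : toeplitz × toeplitz =>
    opTensor (p.1 : Ell2 →L[ℂ] Ell2) (p.2 : Ell2 →L[ℂ] Ell2))).topologicalClosure

instance : CStarAlgebra minTensor :=
  StarSubalgebra.cstarAlgebra _ (h_closed := StarSubalgebra.isClosed_topologicalClosure _)

/-! Shortcuts for instance search. -/

instance : Ring minTensor := inferInstance

instance : Semiring minTensor := inferInstance

instance : Monoid minTensor := inferInstance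

instance : AddCommMonoid minTensor := inferInstance

instance : Algebra ℂ minTensor := inferInstance

instance : NormedSpace ℂ minTensor := inferInstance

instance : Module ℂ minTensor := inferInstance

/-- The element `a ⊗ b` of `𝒯 ⊗ 𝒯`. -/
def tensorElem (a b : toeplitz) : minTensor :=
  ⟨opTensor (a : Ell2 →L[ℂ] Ell2) (b : Ell2 →L[ℂ] Ell2),
    StarSubalgebra.le_topologicalClosure _ (StarAlgebra.subset_adjoin ℂ _ ⟨(a, b), rfl⟩)⟩

lemma closure_span_tensorElem :
    (Submodule.span ℂ (Set.range fun p : toeplitz × toeplitz =>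
      tensorElem p.1 p.2)).topologicalClosure = ⊤ := by
  set s : Set (HTensor Ell2 Ell2 →L[ℂ] HTensor Ell2 Ell2) :=
    Set.range fun p : toeplitz × toeplitz =>
      opTensor (p.1 : Ell2 →L[ℂ] Ell2) (p.2 : Ell2 →L[ℂ] Ell2) with hs
  let M : Submonoid (HTensor Ell2 Ell2 →L[ℂ] HTensor Ell2 Ell2) :=
    { carrier := s
      mul_mem' := by
        rintro _ _ ⟨p, rfl⟩ ⟨q, rfl⟩
        exact ⟨(p.1 * q.1, p.2 * q.2), (opTensor_mul _ _ _ _).symm⟩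
      one_mem' := ⟨(1, 1), opTensor_one_one⟩ }
  have hstar : s ∪ star s = s := by
    refine Set.union_eq_self_of_subset_right ?_
    rintro x ⟨p, hp⟩
    refine ⟨(star p.1, star p.2), ?_⟩
    have := congrArg star hp
    rw [star_star] at this
    rw [← this]
    exact (star_opTensor _ _).symm
  have hspan : ((StarAlgebra.adjoin ℂ s : StarSubalgebra ℂ _) : Set _) =
      (Submodule.span ℂ s : Set (HTensor Ell2 Ell2 →L[ℂ] HTensor Ell2 Ell2)) := by
    have h1 := Algebra.adjoin_eq_span ℂ s
    rw [show Submonoid.closure s = M from Submonoid.closure_eq M] at h1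
    have h2 := StarAlgebra.adjoin_toSubalgebra ℂ s
    rw [hstar] at h2
    change _ = ((Submodule.span ℂ (M : Set (HTensor Ell2 Ell2 →L[ℂ] HTensor Ell2 Ell2)) :
      Submodule ℂ (HTensor Ell2 Ell2 →L[ℂ] HTensor Ell2 Ell2)) :
      Set (HTensor Ell2 Ell2 →L[ℂ] HTensor Ell2 Ell2))
    rw [← h1, ← h2]
    rfl
  refine Submodule.eq_top_iff'.2 fun x => ?_
  have hx : (x : HTensor Ell2 Ell2 →L[ℂ] HTensor Ell2 Ell2) ∈
      closure (Submodule.span ℂ s : Set (HTensor Ell2 Ell2 →L[ℂ] HTensor Ell2 Ell2)) := by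
    rw [← hspan]
    exact x.2
  change x ∈ closure _
  rw [closure_subtype]
  convert hx using 2
  have : s = (minTensor.subtype : minTensor →ₗ[ℂ] _) ''
      (Set.range fun p : toeplitz × toeplitz => tensorElem p.1 p.2) := by
    rw [← Set.range_comp]
    rfl
  rw [this, Submodule.span_image]
  rfl

/-- The vectors `e_{k + d⁺} ⊗ e_{k + d⁻}`, an enumeration of the basis `e_a ⊗ e_b` by
`k = min a b` and `d = a - b`. -/
def diagVec (p : ℕ × ℤ) : HTensor Ell2 Ell2 :=
  vecTensor (stdBasis (p.1 + p.2.toNat)) (stdBasis (p.1 + (-p.2).toNat))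

lemma closure_span_single {ι : Type*} [DecidableEq ι] :
    (Submodule.span ℂ (Set.range fun i : ι =>
      (lp.single 2 i (1 : ℂ) : lp (fun _ : ι => ℂ) 2))).topologicalClosure = ⊤ := by
  refine Submodule.eq_top_iff'.2 fun f => ?_
  refine mem_closure_of_tendsto (lp.hasSum_single (by norm_num) f)
    (Filter.Eventually.of_forall fun s => Submodule.sum_mem _ fun i _ => ?_)
  have : lp.single 2 i (f i) = f i • (lp.single 2 i (1 : ℂ) : lp (fun _ : ι => ℂ) 2) := by
    rw [← lp.single_smul]
    simp
  rw [this]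
  exact Submodule.smul_mem _ _ (Submodule.subset_span ⟨i, rfl⟩)

lemma closure_span_stdBasis :
    (Submodule.span ℂ (Set.range stdBasis)).topologicalClosure = ⊤ := closure_span_single

/-- There is a unique unital `*`-homomorphism `Δ : 𝒯 → 𝒯 ⊗ 𝒯` with `Δ(T) = T ⊗ T`. -/
lemma existsUnique_comul :
    ∃! Δ : toeplitz →⋆ₐ[ℂ] minTensor, Δ toeplitzShift = tensorElem toeplitzShift toeplitzShift := by
  classical
  let δ : ℤ → lp (fun _ : ℤ => ℂ) 2 := fun d => lp.single 2 d (1 : ℂ)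
  have hδ : Orthonormal ℂ δ := by
    rw [orthonormal_iff_ite]
    intro i j
    simp [δ, lp.inner_single_left, Pi.single_apply]
  have hδt : (Submodule.span ℂ (Set.range δ)).topologicalClosure = ⊤ := closure_span_single
  have h1 : Orthonormal ℂ diagVec := by
    rw [orthonormal_iff_ite]
    rintro ⟨k, d⟩ ⟨k', d'⟩
    rw [diagVec, diagVec, inner_vecTensor, orthonormal_iff_ite.1 orthonormal_stdBasis,
      orthonormal_iff_ite.1 orthonormal_stdBasis]
    have : (k = k' ∧ d = d') ↔
      (k + d.toNat = k' + d'.toNat ∧ k + (-d).toNat = k' + (-d').toNat) := by omega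
    simp only [Prod.mk.injEq, this, ite_and]
    split_ifs <;> simp
  have h1t : (Submodule.span ℂ (Set.range diagVec)).topologicalClosure = ⊤ := by
    refine eq_top_of_total closure_span_stdBasis closure_span_stdBasis _
      (Submodule.isClosed_topologicalClosure _) fun a b => ?_
    refine Submodule.le_topologicalClosure _ (Submodule.subset_span
      ⟨(min a b, (a : ℤ) - b), ?_⟩)
    rw [diagVec]
    congr 2 <;> congr 1 <;> omega
  let w : ℕ × ℤ → HTensor Ell2 (lp (fun _ : ℤ => ℂ) 2) := fun p => vecTensor (stdBasis p.1) (δ p.2)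
  have h2 : Orthonormal ℂ w := by
    rw [orthonormal_iff_ite]
    rintro ⟨k, d⟩ ⟨k', d'⟩
    simp only [w]
    rw [inner_vecTensor, orthonormal_iff_ite.1 orthonormal_stdBasis,
      orthonormal_iff_ite.1 hδ]
    simp only [Prod.mk.injEq, ite_and]
    split_ifs <;> simp
  have h2t : (Submodule.span ℂ (Set.range w)).topologicalClosure = ⊤ :=
    eq_top_of_total closure_span_stdBasis hδt _
      (Submodule.isClosed_topologicalClosure _) fun a b =>
        Submodule.le_topologicalClosure _ (Submodule.subset_span ⟨(a, b), rfl⟩)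
  let b1 := HilbertBasis.mk h1 h1t.ge
  let b2 := HilbertBasis.mk h2 h2t.ge
  let W : HTensor Ell2 Ell2 ≃ₗᵢ[ℂ] HTensor Ell2 (lp (fun _ : ℤ => ℂ) 2) :=
    b1.repr.trans b2.repr.symm
  have hW (p : ℕ × ℤ) : W (diagVec p) = w p := by
    have e1 : b1 p = diagVec p := congrFun (HilbertBasis.coe_mk h1 h1t.ge) p
    have e2 : b2 p = w p := congrFun (HilbertBasis.coe_mk h2 h2t.ge) p
    rw [← e1, ← e2]
    simp [W, HilbertBasis.repr_self]
  have hW' (p : ℕ × ℤ) : W.symm (w p) = diagVec p := by rw [← hW, W.symm_apply_apply]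
  let Ψ : (Ell2 →L[ℂ] Ell2) →⋆ₐ[ℂ] (HTensor Ell2 Ell2 →L[ℂ] HTensor Ell2 Ell2) :=
    (StarAlgHomClass.toStarAlgHom W.symm.conjStarAlgEquiv).comp amplification
  have hΨ : Ψ shift = opTensor shift shift := by
    have : (⊤ : Submodule ℂ (HTensor Ell2 Ell2)) ≤
        LinearMap.eqLocus (Ψ shift).toLinearMap (opTensor shift shift).toLinearMap := by
      rw [← h1t]
      refine Submodule.topologicalClosure_minimal _ (Submodule.span_le.2 ?_)
        (isClosed_eq (Ψ shift).continuous (opTensor shift shift).continuous)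
      rintro _ ⟨⟨k, d⟩, rfl⟩
      change W.symm (opTensor shift 1 (W (diagVec (k, d)))) = opTensor shift shift (diagVec (k, d))
      rw [hW]
      have e1 : opTensor shift 1 (w (k, d)) = w (k + 1, d) := by
        simp only [w, opTensor_vecTensor, shift_stdBasis]
        rfl
      rw [e1, hW', diagVec, diagVec, opTensor_vecTensor, shift_stdBasis, shift_stdBasis,
        Nat.add_right_comm, Nat.add_right_comm k 1]
    ext1 v
    exact this (Submodule.mem_top (x := v))
  have hΨc : Continuous Ψ :=
    AddMonoidHomClass.continuous_of_bound Ψ 1 fun x => by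
      simpa using NonUnitalStarAlgHom.norm_apply_le Ψ x
  have hle : toeplitz ≤ minTensor.comap Ψ := by
    refine StarAlgebra.elemental.le_of_mem
      ((StarSubalgebra.isClosed_topologicalClosure _).preimage hΨc) ?_
    change Ψ shift ∈ minTensor
    rw [hΨ]
    exact (tensorElem toeplitzShift toeplitzShift).2
  have h0 : (Ψ.comp toeplitz.subtype).codRestrict minTensor (fun a => hle a.2) toeplitzShift =
      tensorElem toeplitzShift toeplitzShift := Subtype.ext hΨ
  exact ⟨_, h0, fun g hg => starAlgHom_ext _ _ (hg.trans h0.symm)⟩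

/-- The comultiplication `Δ : 𝒯 → 𝒯 ⊗ 𝒯`, the unital `*`-homomorphism with `Δ(T) = T ⊗ T`. -/
def comul : toeplitz →⋆ₐ[ℂ] minTensor := existsUnique_comul.choose

lemma comul_shift : comul toeplitzShift = tensorElem toeplitzShift toeplitzShift :=
  existsUnique_comul.choose_spec.1

/-- For `ρ, φ ∈ 𝒯*` there is a unique bounded functional on `𝒯 ⊗ 𝒯` with
`a ⊗ b ↦ ρ(a) φ(b)`. -/
lemma existsUnique_tensorFunctional (ρ φ : StrongDual ℂ toeplitz) :
    ∃! Φ : StrongDual ℂ minTensor, ∀ a b, Φ (tensorElem a b) = ρ a * φ b := by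
  obtain ⟨ρ', hρ', -⟩ := exists_extension_norm_eq toeplitz.toSubalgebra.toSubmodule ρ
  obtain ⟨φ', hφ', -⟩ := exists_extension_norm_eq toeplitz.toSubalgebra.toSubmodule φ
  obtain ⟨Φ, hΦ⟩ := exists_functional_tensor ρ' φ'
  have h0 : ∀ a b : toeplitz, Φ (tensorElem a b : HTensor Ell2 Ell2 →L[ℂ] HTensor Ell2 Ell2) =
      ρ a * φ b := fun a b => by
    rw [← hρ' a, ← hφ' b]
    exact hΦ a b
  refine ⟨Φ.comp (minTensor.toSubalgebra.toSubmodule.subtypeL), h0, fun Φ' h' => ?_⟩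
  have : (⊤ : Submodule ℂ minTensor) ≤ LinearMap.eqLocus Φ'.toLinearMap
      (Φ.comp (minTensor.toSubalgebra.toSubmodule.subtypeL)).toLinearMap := by
    rw [← closure_span_tensorElem]
    refine Submodule.topologicalClosure_minimal _ (Submodule.span_le.2 ?_)
      (isClosed_eq Φ'.continuous (ContinuousLinearMap.continuous _))
    rintro _ ⟨⟨a, b⟩, rfl⟩
    exact (h' a b).trans (h0 a b).symm
  ext v
  exact this (Submodule.mem_top (x := v))

/-- The functional `ρ ⊗ φ` on `𝒯 ⊗ 𝒯`, the bounded functional with `a ⊗ b ↦ ρ(a) φ(b)`. -/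
def tensorFunctional (ρ φ : StrongDual ℂ toeplitz) : StrongDual ℂ minTensor :=
  (existsUnique_tensorFunctional ρ φ).choose

lemma tensorFunctional_tensorElem (ρ φ : StrongDual ℂ toeplitz) (a b : toeplitz) :
    tensorFunctional ρ φ (tensorElem a b) = ρ a * φ b :=
  (existsUnique_tensorFunctional ρ φ).choose_spec.1 a b

/-- The comultiplication as a continuous linear map. -/
def comulL : toeplitz →L[ℂ] minTensor where
  toLinearMap := comul.toAlgHom.toLinearMap
  cont := AddMonoidHomClass.continuous_of_bound comul 1 fun x => by
    simpa using NonUnitalStarAlgHom.norm_apply_le comul x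

/-- The product `(ρ ∗ φ)(A) = (ρ ⊗ φ)(Δ(A))` on the dual space `𝒯*`. -/
def conv (ρ φ : StrongDual ℂ toeplitz) : StrongDual ℂ toeplitz :=
  (tensorFunctional ρ φ).comp comulL

/-! ### Complex measures on the circle -/

open MeasureTheory

instance : MeasurableSpace Circle := borel Circle

instance : BorelSpace Circle := ⟨rfl⟩

/-- `M(S¹)`: the complex Borel measures on the circle (all of them are regular). -/
abbrev CircleMeasure : Type := ComplexMeasure Circle

instance isFiniteMeasure_variation (μ : CircleMeasure) : IsFiniteMeasure μ.variation := by
  refine isFiniteMeasure_of_le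
    ((ComplexMeasure.re μ).totalVariation + (ComplexMeasure.im μ).totalVariation)
    (VectorMeasure.variation_le_of_forall_enorm_le fun s _ => ?_)
  have h : ‖μ s‖ ≤ ‖(μ s).re‖ + ‖(μ s).im‖ := Complex.norm_le_abs_re_add_abs_im _
  have h' : ‖μ s‖ₑ ≤ ‖(μ s).re‖ₑ + ‖(μ s).im‖ₑ := by
    simp only [← ofReal_norm]
    rw [← ENNReal.ofReal_add (norm_nonneg _) (norm_nonneg _)]
    exact ENNReal.ofReal_le_ofReal h
  exact h'.trans (add_le_add (SignedMeasure.enorm_le_totalVariation (ComplexMeasure.re μ) s)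
    (SignedMeasure.enorm_le_totalVariation (ComplexMeasure.im μ) s))

/-- The integral `∫ f dμ` of a complex function against a complex measure. -/
def cintegral (μ : CircleMeasure) (f : Circle → ℂ) : ℂ :=
  μ.integral f (ContinuousLinearMap.mul ℝ ℂ)

lemma integrable_continuousMap (μ : CircleMeasure) (f : C(Circle, ℂ)) : μ.Integrable f :=
  Integrable.of_bound f.continuous.aestronglyMeasurable ‖f‖
    (Filter.Eventually.of_forall fun x => f.norm_coe_le_norm x)

lemma cintegral_smul (μ : CircleMeasure) (c : ℂ) (f : Circle → ℂ) :
    cintegral μ (c • f) = c * cintegral μ f := by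
  refine setToFun_smul (𝕜 := ℂ) _ (fun c s x => ?_) c f
  change c * x * μ s = c * (x * μ s)
  ring

lemma cintegral_smul_measure (μ : CircleMeasure) (c : ℂ) (f : Circle → ℂ)
    (hf : μ.Integrable f) : cintegral (c • μ) f = c * cintegral μ f := by
  set B := ContinuousLinearMap.mul ℝ ℂ with hB
  have hv : (c • μ).variation = ‖c‖₊ • μ.variation := VectorMeasure.variation_smul
  have h1 := dominatedFinMeasAdditive_cbmApplyMeasure (c • μ) B
  have hT : DominatedFinMeasAdditive μ.variation ((c • μ).transpose B) (‖c‖ * ‖B‖) := by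
    refine ⟨fun s t hs ht _ _ hd =>
      h1.1 s t hs ht (measure_ne_top _ _) (measure_ne_top _ _) hd, fun s hs _ => ?_⟩
    refine (h1.2 s hs (measure_lt_top _ _)).trans (le_of_eq ?_)
    rw [hv, measureReal_nnreal_smul_apply, coe_nnnorm]
    ring
  have h2 (g : Circle → ℂ) (hg : μ.Integrable g) :
      cintegral (c • μ) g = setToFun μ.variation ((c • μ).transpose B) hT g := by
    refine (setToFun_congr_measure_of_integrable ‖c‖₊ ENNReal.coe_ne_top ?_ hT h1 g hg).symm
    rw [hv]
    exact le_rfl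
  rw [h2 f hf]
  refine Integrable.induction
    (P := fun g => setToFun μ.variation ((c • μ).transpose B) hT g = c * cintegral μ g)
    ?_ ?_ ?_ ?_ hf
  · intro x s hs hs'
    rw [setToFun_indicator_const _ hs hs'.ne]
    have : cintegral μ (s.indicator fun _ => x) = x * μ s :=
      setToFun_indicator_const _ hs hs'.ne x
    rw [this]
    change x * (c * μ s) = c * (x * μ s)
    ring
  · intro g g' _ hg hg' h h'
    rw [setToFun_add hT hg hg', h, h', ← mul_add]
    congr 1
    exact (VectorMeasure.integral_fun_add hg hg').symm
  · exact isClosed_eq (continuous_setToFun hT)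
      (continuous_const.mul VectorMeasure.continuous_integral)
  · intro g g' hgg' _ h
    rw [← setToFun_congr_ae hT hgg', h]
    congr 1
    exact setToFun_congr_ae _ hgg'

/-- The bounded functional `f ↦ ∫ f dμ` on `C(S¹)`, depending linearly on `μ ∈ M(S¹)`. -/
def integralFunctional : CircleMeasure →ₗ[ℂ] StrongDual ℂ C(Circle, ℂ) where
  toFun μ := LinearMap.mkContinuous
    { toFun := fun f => cintegral μ f
      map_add' := fun f g => VectorMeasure.integral_fun_add (integrable_continuousMap μ f)
        (integrable_continuousMap μ g)
      map_smul' := fun c f => cintegral_smul μ c f }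
    (‖ContinuousLinearMap.mul ℝ ℂ‖ * μ.variation.real Set.univ) fun f => by
      refine (VectorMeasure.norm_integral_le_of_norm_le_const (C := ‖f‖)
        (Filter.Eventually.of_forall fun x => f.norm_coe_le_norm x)).trans (le_of_eq ?_)
      ring
  map_add' μ ν := by
    ext f
    exact VectorMeasure.integral_add_vectorMeasure (integrable_continuousMap μ f)
      (integrable_continuousMap ν f)
  map_smul' c μ := by
    ext f
    exact cintegral_smul_measure μ c f (integrable_continuousMap μ f)

lemma integralFunctional_apply (μ : CircleMeasure) (f : C(Circle, ℂ)) :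
    integralFunctional μ f = cintegral μ f := rfl

/-- The convolution of complex measures: the image of the product measure under multiplication
in the circle. -/
def measureConv (μ ν : CircleMeasure) : CircleMeasure :=
  (μ.prod ν (ContinuousLinearMap.mul ℝ ℂ)).map fun p : Circle × Circle => p.1 * p.2

/-- The normalized Haar measure on the circle, as a complex measure. -/
def haarCircle : CircleMeasure :=
  ((Measure.haarMeasure (⊤ : TopologicalSpace.PositiveCompacts Circle)).toSignedMeasure).toComplexMeasure 0

/-- The symbol map `γ : 𝒯 → C(S¹)`, the unital `*`-homomorphism with `γ(T) = e^{-iθ}`. -/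
def symbol : toeplitz →⋆ₐ[ℂ] C(Circle, ℂ) := existsUnique_symbol.choose

lemma symbol_shift : symbol toeplitzShift = star circleVar := existsUnique_symbol.choose_spec.1

set_option synthInstance.maxHeartbeats 200000 in
/-- The symbol of `T_{n,m}` is `e^{ikθ}` with `k = m - n`. -/
lemma symbol_monomial (n m : ℕ) (z : Circle) :
    symbol (monomial n m) z = (z : ℂ) ^ ((m : ℤ) - n) := by
  have hz := z.coe_ne_zero
  rw [monomial, map_mul, map_pow, map_pow, map_star, symbol_shift, star_star]
  have : (starRingEnd ℂ) (z : ℂ) = (z : ℂ)⁻¹ := by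
    rw [← Circle.coe_inv_eq_conj, Circle.coe_inv]
  simp only [ContinuousMap.mul_apply, ContinuousMap.pow_apply, ContinuousMap.star_apply,
    circleVar_apply, RCLike.star_def, this, zpow_sub₀ hz, zpow_natCast, inv_pow]
  rw [div_eq_mul_inv, mul_comm]

/-- The symbol map as a continuous linear map. -/
def symbolL : toeplitz →L[ℂ] C(Circle, ℂ) where
  toLinearMap := symbol.toAlgHom.toLinearMap
  cont := AddMonoidHomClass.continuous_of_bound symbol 1 fun x => by
    simpa using NonUnitalStarAlgHom.norm_apply_le symbol x

/-- The map `M(S¹) → 𝒯*` sending `μ` to the functional `A ↦ ∫ γ(A) dμ`. -/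
def measureFunctional : CircleMeasure →ₗ[ℂ] StrongDual ℂ toeplitz where
  toFun μ := (integralFunctional μ).comp symbolL
  map_add' μ ν := by ext; simp
  map_smul' c μ := by ext; simp

lemma measureFunctional_apply (μ : CircleMeasure) (A : toeplitz) :
    measureFunctional μ A = cintegral μ (symbol A) := rfl

/-! ### Haar functionals -/

/-- `𝒦^⊥`: the functionals in `𝒯*` that vanish on the compact operators. -/
def compactAnnihilator : Submodule ℂ (StrongDual ℂ toeplitz) where
  carrier := {ρ | ∀ A : toeplitz, IsCompactOperator (A : Ell2 →L[ℂ] Ell2) → ρ A = 0}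
  add_mem' {ρ φ} hρ hφ A hA := by
    rw [add_apply, hρ A hA, hφ A hA, add_zero]
  zero_mem' _ _ := rfl
  smul_mem' c ρ hρ A hA := by
    rw [smul_apply, hρ A hA, smul_zero]

/-- States of the Toeplitz algebra: positive functionals with value `1` at the identity. -/
def IsState (ρ : StrongDual ℂ toeplitz) : Prop :=
  (∀ A : toeplitz, 0 ≤ ρ (star A * A)) ∧ ρ 1 = 1

/-- A Haar functional in a space `V` of functionals on `𝒯` (here `V` is `𝒯*` or `𝒦^⊥`): a state
`h ∈ V` such that for every `ρ ∈ V` there is a scalar `c` with `h ∗ ρ = ρ ∗ h = c h`. -/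
structure IsHaarFunctional (V : Submodule ℂ (StrongDual ℂ toeplitz))
    (h : StrongDual ℂ toeplitz) : Prop where
  mem : h ∈ V
  isState : IsState h
  invariant : ∀ ρ ∈ V, ∃ c : ℂ, conv h ρ = c • h ∧ conv ρ h = c • h

end

end ToeplitzQS

/-
On `𝒯` the product of functionals is pointwise multiplication of their values on the monomials
`T_{n,m}`, whose span is dense. So the product is commutative, and two Haar functionals
`h, h'` coincide: `h * h'` is a multiple of both, and evaluation at `1` gives `h = h * h' = h'`.

A functional killing the compact operators factors through the symbol map `γ`: the Toeplitz
operator of a continuous function is a bounded linear section of `γ` modulo the compacts, since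
`A - T_{γ(A)}` is compact for every `A ∈ 𝒯`. Conversely `γ` kills the compacts, because
`(T*)ⁿ K → 0` in norm for `K` compact, whereas `γ(T*)` is unimodular. With the Riesz representation
theorem for complex measures this identifies `𝒦^⊥` with `M(S¹)`. Integration against Haar measure
kills `T_{n,m}` for `n ≠ m`, and the vector state of `e₀` vanishes on all `T_{n,m}` except
`T_{0,0} = 1`.
-/

namespace ToeplitzQS

noncomputable section

open MeasureTheory

open scoped NNReal Pointwise Topology

section ComplexMeasure

variable {X : Type*} [MeasurableSpace X]

/-- A finite positive measure, viewed as a complex measure. -/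
def ofMeasure (m : Measure X) [IsFiniteMeasure m] : ComplexMeasure X :=
  m.toSignedMeasure.toComplexMeasure 0

lemma ofMeasure_apply (m : Measure X) [IsFiniteMeasure m] {s : Set X} (hs : MeasurableSet s) :
    ofMeasure m s = (m.real s : ℂ) := by
  rw [ofMeasure, SignedMeasure.toComplexMeasure_apply,
    Measure.toSignedMeasure_apply_measurable hs]
  rfl

lemma variation_ofMeasure (m : Measure X) [IsFiniteMeasure m] : (ofMeasure m).variation = m := by
  have enorm_apply (s : Set X) (hs : MeasurableSet s) : ‖ofMeasure m s‖ₑ = m s := by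
    rw [ofMeasure_apply m hs, ← ofReal_norm, Complex.norm_real,
      Real.norm_of_nonneg measureReal_nonneg, ofReal_measureReal]
  refine le_antisymm
    (VectorMeasure.variation_le_of_forall_enorm_le fun s hs => (enorm_apply s hs).le)
    (Measure.le_iff.2 fun s hs => ?_)
  rw [← enorm_apply s hs]
  exact VectorMeasure.enorm_measure_le_variation _ _

lemma integral_ofMeasure (m : Measure X) [IsFiniteMeasure m] (f : X → ℂ) :
    (ofMeasure m).integral f (ContinuousLinearMap.mul ℝ ℂ) = ∫ x, f x ∂m := by
  rw [VectorMeasure.integral_eq_setToFun, MeasureTheory.integral_eq_setToFun]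
  simp only [variation_ofMeasure]
  refine setToFun_congr_left' _ _ (fun s hs _ => ?_) _
  ext x
  change x * ofMeasure m s = m.real s • x
  rw [ofMeasure_apply m hs, mul_comm, Complex.real_smul]

lemma eq_ofMeasure_jordanDecomposition (μ : ComplexMeasure X) :
    μ = (ofMeasure (ComplexMeasure.re μ).toJordanDecomposition.posPart +
      (-1 : ℂ) • ofMeasure (ComplexMeasure.re μ).toJordanDecomposition.negPart) +
      Complex.I • (ofMeasure (ComplexMeasure.im μ).toJordanDecomposition.posPart +
      (-1 : ℂ) • ofMeasure (ComplexMeasure.im μ).toJordanDecomposition.negPart) := by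
  refine VectorMeasure.ext fun s hs => ?_
  have hre : (μ s).re = _ := (ComplexMeasure.re μ).apply_eq_posPart_real_sub_negPart_real hs
  have him : (μ s).im = _ := (ComplexMeasure.im μ).apply_eq_posPart_real_sub_negPart_real hs
  simp only [add_apply, smul_apply, ofMeasure_apply _ hs, smul_eq_mul]
  apply Complex.ext
  · simp [hre, sub_eq_add_neg]
  · simp [him, sub_eq_add_neg]

lemma complexMeasure_induction {P : ComplexMeasure X → Prop}
    (pos : ∀ (m : Measure X) [IsFiniteMeasure m], P (ofMeasure m))
    (add : ∀ μ ν, P μ → P ν → P (μ + ν)) (smul : ∀ (c : ℂ) μ, P μ → P (c • μ))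
    (μ : ComplexMeasure X) : P μ := by
  rw [eq_ofMeasure_jordanDecomposition μ]
  exact add _ _ (add _ _ (pos _) (smul _ _ (pos _)))
    (smul _ _ (add _ _ (pos _) (smul _ _ (pos _))))

lemma eq_zero_of_forall_integral_continuousMap_eq_zero [TopologicalSpace X] [CompactSpace X]
    [NormalSpace X] [BorelSpace X] {μ : ComplexMeasure X} [IsFiniteMeasure μ.variation]
    [μ.variation.WeaklyRegular]
    (h : ∀ f : C(X, ℂ), μ.integral f (ContinuousLinearMap.mul ℝ ℂ) = 0) : μ = 0 := by
  have h_L1 (f : X →₁[μ.variation] ℂ) : μ.integral f (ContinuousLinearMap.mul ℝ ℂ) = 0 := by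
    refine (ContinuousMap.toLp_denseRange ℂ μ.variation ℂ ENNReal.one_ne_top).induction_on f
      (isClosed_eq VectorMeasure.continuous_integral continuous_const) fun g => ?_
    exact (VectorMeasure.integral_congr_ae (ContinuousMap.coeFn_toLp _ g)).trans (h g)
  refine VectorMeasure.ext fun s hs => ?_
  have hs' : μ.variation s ≠ ⊤ := measure_ne_top _ s
  calc μ s = μ.integral (s.indicator fun _ => (1 : ℂ)) (ContinuousLinearMap.mul ℝ ℂ) :=
        ((setToFun_indicator_const _ hs hs' 1).trans (one_mul (μ s))).symm
    _ = μ.integral (indicatorConstLp 1 hs hs' (1 : ℂ)) (ContinuousLinearMap.mul ℝ ℂ) :=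
        (VectorMeasure.integral_congr_ae indicatorConstLp_coeFn).symm
    _ = 0 := h_L1 _

end ComplexMeasure

section VectorLattice

variable {E : Type*} [AddCommGroup E] [Lattice E]

lemma Icc_zero_add [IsOrderedAddMonoid E] {f g : E} (hf : 0 ≤ f) (hg : 0 ≤ g) :
    Set.Icc 0 (f + g) = Set.Icc 0 f + Set.Icc 0 g := by
  refine subset_antisymm (fun k hk => Set.mem_add.2 ?_) ?_
  · refine ⟨k ⊓ f, ⟨le_inf hk.1 hf, inf_le_right⟩, k - k ⊓ f, ⟨sub_nonneg.2 inf_le_left, ?_⟩,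
      add_sub_cancel _ _⟩
    rw [sub_le_iff_le_add', inf_add]
    exact le_inf (le_add_of_nonneg_right hg) hk.2
  · simpa only [add_zero] using Set.Icc_add_Icc_subset (0 : E) f 0 g

variable [Module ℝ E]

/-- The positive part `f ↦ sup Λ [0, f]` of an order bounded functional `Λ` on a vector lattice,
meaningful for `0 ≤ f` only. -/
def positivePart (Λ : E →ₗ[ℝ] ℝ) (f : E) : ℝ := sSup (Λ '' Set.Icc 0 f)

variable {Λ : E →ₗ[ℝ] ℝ} {f g : E}

lemma le_positivePart (hΛ : BddAbove (Λ '' Set.Icc 0 f)) (hf : 0 ≤ f) : Λ f ≤ positivePart Λ f :=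
  le_csSup hΛ ⟨f, Set.right_mem_Icc.2 hf, rfl⟩

lemma positivePart_nonneg (hΛ : BddAbove (Λ '' Set.Icc 0 f)) (hf : 0 ≤ f) :
    0 ≤ positivePart Λ f :=
  le_csSup hΛ ⟨0, Set.left_mem_Icc.2 hf, map_zero Λ⟩

lemma positivePart_smul [PosSMulMono ℝ E] (c : ℝ≥0) :
    positivePart Λ ((c : ℝ) • f) = c * positivePart Λ f := by
  obtain rfl | hc := eq_zero_or_pos c
  · simp [positivePart]
  have smul_Icc : Set.Icc 0 ((c : ℝ) • f) = (c : ℝ) • Set.Icc 0 f := by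
    simpa using ((OrderIso.smulRight (β := E) (NNReal.coe_pos.2 hc)).image_Icc 0 f).symm
  rw [positivePart, smul_Icc, Set.image_smul_comm _ _ _ (map_smul Λ _),
    Real.sSup_smul_of_nonneg c.coe_nonneg, smul_eq_mul, positivePart]

lemma positivePart_add [IsOrderedAddMonoid E] (hΛ : ∀ f, BddAbove (Λ '' Set.Icc 0 f))
    (hf : 0 ≤ f) (hg : 0 ≤ g) :
    positivePart Λ (f + g) = positivePart Λ f + positivePart Λ g := by
  have nonempty {f : E} (hf : 0 ≤ f) : (Λ '' Set.Icc 0 f).Nonempty :=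
    (Set.nonempty_Icc.2 hf).image Λ
  rw [positivePart, Icc_zero_add hf hg, Set.image_add,
    csSup_add (nonempty hf) (hΛ f) (nonempty hg) (hΛ g), positivePart, positivePart]

end VectorLattice

section Riesz

variable {X : Type*} [TopologicalSpace X]

lemma ext_of_forall_ofReal {Φ Ψ : StrongDual ℂ C(X, ℂ)}
    (h : ∀ f : C(X, ℝ), Φ (Complex.ofRealCLM.compLeftContinuous ℝ X f) =
      Ψ (Complex.ofRealCLM.compLeftContinuous ℝ X f)) : Φ = Ψ := by
  ext f
  let re : C(X, ℝ) := ⟨fun x => (f x).re, by fun_prop⟩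
  let im : C(X, ℝ) := ⟨fun x => (f x).im, by fun_prop⟩
  have hf : f = Complex.ofRealCLM.compLeftContinuous ℝ X re +
      Complex.I • Complex.ofRealCLM.compLeftContinuous ℝ X im := by
    ext x
    exact (Complex.re_add_im (f x)).symm.trans (by rw [mul_comm]; rfl)
  rw [hf, map_add, map_add, map_smul, map_smul, h, h]

variable [CompactSpace X]

lemma bddAbove_image_Icc (Λ : StrongDual ℝ C(X, ℝ)) (f : C(X, ℝ)) :
    BddAbove (Λ.toLinearMap '' Set.Icc 0 f) := by
  refine ⟨‖Λ‖ * ‖f‖, ?_⟩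
  rintro _ ⟨g, hg, rfl⟩
  have norm_le : ‖g‖ ≤ ‖f‖ := (ContinuousMap.norm_le _ (norm_nonneg _)).2 fun x =>
    (Real.norm_of_nonneg (hg.1 x)).trans_le <|
      (hg.2 x).trans ((le_abs_self _).trans (f.norm_coe_le_norm x))
  exact (le_abs_self _).trans (Λ.le_opNorm_of_le norm_le)

variable [T2Space X] [MeasurableSpace X] [BorelSpace X]

lemma exists_measure_of_cone (q : C(X, ℝ) → ℝ) (hq : ∀ f, 0 ≤ f → 0 ≤ q f)
    (hadd : ∀ f g, 0 ≤ f → 0 ≤ g → q (f + g) = q f + q g)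
    (hsmul : ∀ (c : ℝ≥0) f, 0 ≤ f → q ((c : ℝ) • f) = c * q f) :
    ∃ m : Measure X, IsFiniteMeasure m ∧ ∀ f : C(X, ℝ), 0 ≤ f → ∫ x, f x ∂m = q f := by
  let toReal (f : CompactlySupportedContinuousMap X ℝ≥0) : C(X, ℝ) :=
    ⟨fun x => (f x : ℝ), by fun_prop⟩
  have toReal_nonneg (f : CompactlySupportedContinuousMap X ℝ≥0) : 0 ≤ toReal f :=
    fun x => (f x).2
  let Λ : CompactlySupportedContinuousMap X ℝ≥0 →ₗ[ℝ≥0] ℝ≥0 :=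
    { toFun := fun f => ⟨q (toReal f), hq _ (toReal_nonneg f)⟩
      map_add' := fun f g =>
        NNReal.eq (hadd (toReal f) (toReal g) (toReal_nonneg f) (toReal_nonneg g))
      map_smul' := fun c f => NNReal.eq (hsmul c (toReal f) (toReal_nonneg f)) }
  refine ⟨NNRealRMK.rieszMeasure Λ, inferInstance, fun f hf => ?_⟩
  let toNNReal : CompactlySupportedContinuousMap X ℝ≥0 :=
    ⟨⟨fun x => (f x).toNNReal, by fun_prop⟩, HasCompactSupport.of_compactSpace _⟩
  have coe_toNNReal (x : X) : (toNNReal x : ℝ) = f x := Real.coe_toNNReal _ (hf x)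
  calc ∫ x, f x ∂(NNRealRMK.rieszMeasure Λ)
      = ∫ x, (toNNReal x : ℝ) ∂(NNRealRMK.rieszMeasure Λ) := by simp only [coe_toNNReal]
    _ = q (toReal toNNReal) := NNRealRMK.integral_rieszMeasure Λ toNNReal
    _ = q f := congrArg q (ContinuousMap.ext coe_toNNReal)

lemma exists_measures_of_strongDual (Λ : StrongDual ℝ C(X, ℝ)) :
    ∃ m m' : Measure X, IsFiniteMeasure m ∧ IsFiniteMeasure m' ∧
      ∀ f : C(X, ℝ), Λ f = ∫ x, f x ∂m - ∫ x, f x ∂m' := by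
  have hΛ := bddAbove_image_Icc Λ
  obtain ⟨m, hm, hm_int⟩ := exists_measure_of_cone (positivePart Λ.toLinearMap)
    (fun f => positivePart_nonneg (hΛ f)) (fun f g => positivePart_add hΛ)
    (fun c f _ => positivePart_smul c)
  obtain ⟨m', hm', hm'_int⟩ := exists_measure_of_cone (fun f => positivePart Λ.toLinearMap f - Λ f)
    (fun f hf => sub_nonneg.2 (le_positivePart (hΛ f) hf))
    (fun f g hf hg => by simp only [positivePart_add hΛ hf hg, map_add]; ring)
    (fun c f _ => by simp only [positivePart_smul, map_smul, smul_eq_mul]; ring)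
  refine ⟨m, m', hm, hm', fun f => ?_⟩
  have of_nonneg (g : C(X, ℝ)) (hg : 0 ≤ g) : Λ g = ∫ x, g x ∂m - ∫ x, g x ∂m' := by
    rw [hm_int g hg, hm'_int g hg, sub_sub_cancel]
  have integrable (n : Measure X) [IsFiniteMeasure n] (g : C(X, ℝ)) : Integrable g n :=
    g.continuous.integrable_of_hasCompactSupport (HasCompactSupport.of_compactSpace _)
  obtain ⟨a, b, ha, hb, rfl⟩ : ∃ a b : C(X, ℝ), 0 ≤ a ∧ 0 ≤ b ∧ f = a - b :=
    ⟨f ⊔ 0, f ⊔ 0 - f, le_sup_right, sub_nonneg.2 le_sup_left, (sub_sub_cancel _ _).symm⟩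
  rw [map_sub, of_nonneg a ha, of_nonneg b hb]
  simp only [ContinuousMap.sub_apply]
  rw [integral_sub (integrable m a) (integrable m b),
    integral_sub (integrable m' a) (integrable m' b)]
  ring

end Riesz

section Circle

lemma cintegral_ofMeasure (m : Measure Circle) [IsFiniteMeasure m] (f : Circle → ℂ) :
    cintegral (ofMeasure m) f = ∫ x, f x ∂m := integral_ofMeasure m f

lemma integralFunctional_injective : Function.Injective integralFunctional :=
  (injective_iff_map_eq_zero _).2 fun _ hμ =>
    eq_zero_of_forall_integral_continuousMap_eq_zero (DFunLike.congr_fun hμ)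

lemma integralFunctional_surjective : Function.Surjective integralFunctional := by
  intro Φ
  let ofReal : C(Circle, ℝ) →L[ℝ] C(Circle, ℂ) := Complex.ofRealCLM.compLeftContinuous ℝ Circle
  let Φ' : C(Circle, ℂ) →L[ℝ] ℂ := Φ.restrictScalars ℝ
  obtain ⟨m₁, m₂, _, _, h_re⟩ := exists_measures_of_strongDual (Complex.reCLM ∘L Φ' ∘L ofReal)
  obtain ⟨m₃, m₄, _, _, h_im⟩ := exists_measures_of_strongDual (Complex.imCLM ∘L Φ' ∘L ofReal)
  refine ⟨(ofMeasure m₁ - ofMeasure m₂) + Complex.I • (ofMeasure m₃ - ofMeasure m₄),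
    ext_of_forall_ofReal fun f => ?_⟩
  have integral_eq (n : Measure Circle) [IsFiniteMeasure n] :
      integralFunctional (ofMeasure n) (ofReal f) = ((∫ x, f x ∂n : ℝ) : ℂ) := by
    rw [integralFunctional_apply, cintegral_ofMeasure]
    exact integral_ofReal
  calc _ = (((∫ x, f x ∂m₁) - ∫ x, f x ∂m₂ : ℝ) : ℂ) +
        (((∫ x, f x ∂m₃) - ∫ x, f x ∂m₄ : ℝ) : ℂ) * Complex.I := by
        simp only [map_add, map_sub, map_smul, add_apply, sub_apply, smul_apply, smul_eq_mul]
        rw [integral_eq, integral_eq, integral_eq, integral_eq]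
        push_cast
        ring
    _ = ((Φ (ofReal f)).re : ℂ) + ((Φ (ofReal f)).im : ℂ) * Complex.I := by
        rw [← h_re f, ← h_im f]
        rfl
    _ = Φ (ofReal f) := Complex.re_add_im _

lemma measureConv_apply (μ ν : CircleMeasure) {s : Set Circle} (hs : MeasurableSet s) :
    measureConv μ ν s = μ.prod ν (ContinuousLinearMap.mul ℝ ℂ)
      ((fun p : Circle × Circle => p.1 * p.2) ⁻¹' s) :=
  VectorMeasure.map_apply _ (by fun_prop) hs

lemma measureConv_add_left (μ μ' ν : CircleMeasure) :
    measureConv (μ + μ') ν = measureConv μ ν + measureConv μ' ν := by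
  have prod_add : (μ + μ').prod ν (ContinuousLinearMap.mul ℝ ℂ) =
      μ.prod ν (ContinuousLinearMap.mul ℝ ℂ) + μ'.prod ν (ContinuousLinearMap.mul ℝ ℂ) :=
    VectorMeasure.prod_eq_of_forall_apply_prod fun s t _ _ => by simp
  refine VectorMeasure.ext fun s hs => ?_
  simp only [add_apply, measureConv_apply _ _ hs, prod_add]

lemma measureConv_smul_left (c : ℂ) (μ ν : CircleMeasure) :
    measureConv (c • μ) ν = c • measureConv μ ν := by
  have prod_smul : (c • μ).prod ν (ContinuousLinearMap.mul ℝ ℂ) =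
      c • μ.prod ν (ContinuousLinearMap.mul ℝ ℂ) :=
    VectorMeasure.prod_eq_of_forall_apply_prod fun s t _ _ => by simp [mul_assoc]
  refine VectorMeasure.ext fun s hs => ?_
  simp only [smul_apply, measureConv_apply _ _ hs, prod_smul]

lemma measureConv_comm (μ ν : CircleMeasure) : measureConv μ ν = measureConv ν μ := by
  have prod_swap : μ.prod ν (ContinuousLinearMap.mul ℝ ℂ) =
      (ν.prod μ (ContinuousLinearMap.mul ℝ ℂ)).map Prod.swap :=
    VectorMeasure.prod_eq_of_forall_apply_prod fun s t hs ht => by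
      rw [VectorMeasure.map_apply _ measurable_swap (hs.prod ht), Set.preimage_swap_prod,
        VectorMeasure.prod_apply]
      simp [mul_comm]
  refine VectorMeasure.ext fun s hs => ?_
  rw [measureConv_apply _ _ hs, measureConv_apply _ _ hs, prod_swap,
    VectorMeasure.map_apply _ measurable_swap (measurable_mul hs), ← Set.preimage_comp]
  simp only [Function.comp_def, Prod.fst_swap, Prod.snd_swap, mul_comm]

lemma measureConv_ofMeasure (m m' : Measure Circle) [IsFiniteMeasure m] [IsFiniteMeasure m'] :
    measureConv (ofMeasure m) (ofMeasure m') = ofMeasure ((m.prod m').map fun p => p.1 * p.2) := by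
  have prod_ofMeasure : (ofMeasure m).prod (ofMeasure m') (ContinuousLinearMap.mul ℝ ℂ) =
      ofMeasure (m.prod m') :=
    VectorMeasure.prod_eq_of_forall_apply_prod fun s t hs ht => by
      simp [ofMeasure_apply _ (hs.prod ht), ofMeasure_apply _ hs, ofMeasure_apply _ ht,
        measureReal_prod_prod]
  refine VectorMeasure.ext fun s hs => ?_
  rw [measureConv_apply _ _ hs, prod_ofMeasure, ofMeasure_apply _ (measurable_mul hs),
    ofMeasure_apply _ hs, map_measureReal_apply (by fun_prop) hs]

lemma integralFunctional_measureConv (χ : C(Circle, ℂ)) (hχ : ∀ z w, χ (z * w) = χ z * χ w)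
    (μ ν : CircleMeasure) : integralFunctional (measureConv μ ν) χ =
      integralFunctional μ χ * integralFunctional ν χ := by
  induction μ using complexMeasure_induction with
  | add μ μ' h h' => simp only [measureConv_add_left, map_add, add_apply, h, h', add_mul]
  | smul c μ h => simp only [measureConv_smul_left, map_smul, smul_apply, h, smul_mul_assoc]
  | pos m =>
    rw [measureConv_comm, mul_comm]
    induction ν using complexMeasure_induction with
    | add ν ν' h h' => simp only [measureConv_add_left, map_add, add_apply, h, h', add_mul]
    | smul c ν h => simp only [measureConv_smul_left, map_smul, smul_apply, h, smul_mul_assoc]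
    | pos m' =>
      simp only [measureConv_ofMeasure, integralFunctional_apply, cintegral_ofMeasure]
      rw [MeasureTheory.integral_map (by fun_prop) χ.continuous.aestronglyMeasurable]
      simp only [hχ]
      exact integral_prod_mul _ _

end Circle

section Monomials

/-- The submonoid of the products `u ^ n * v ^ m` generated by elements with `v * u = 1`. -/
def bicyclicSubmonoid {M : Type*} [Monoid M] {u v : M} (h : v * u = 1) : Submonoid M where
  carrier := Set.range fun p : ℕ × ℕ => u ^ p.1 * v ^ p.2
  one_mem' := ⟨(0, 0), by simp only [pow_zero, mul_one]⟩
  mul_mem' := by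
    rintro _ _ ⟨⟨n, m⟩, rfl⟩ ⟨⟨p, q⟩, rfl⟩
    obtain ⟨k, rfl⟩ | ⟨k, rfl⟩ := (le_total m p).imp Nat.exists_eq_add_of_le
      Nat.exists_eq_add_of_le'
    · refine ⟨(n + k, q), ?_⟩
      calc u ^ (n + k) * v ^ q = u ^ n * (v ^ m * u ^ m) * u ^ k * v ^ q := by
            rw [pow_mul_pow_eq_one m h, mul_one, pow_add]
        _ = u ^ n * v ^ m * (u ^ (m + k) * v ^ q) := by simp only [pow_add, mul_assoc]
    · refine ⟨(n, k + q), ?_⟩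
      calc u ^ n * v ^ (k + q) = u ^ n * v ^ k * (v ^ p * u ^ p) * v ^ q := by
            rw [pow_mul_pow_eq_one p h, mul_one, pow_add, mul_assoc]
        _ = u ^ n * v ^ (k + p) * (u ^ p * v ^ q) := by simp only [pow_add, mul_assoc]

lemma elemental_subset_closure_span {A : Type*} [Ring A] [Algebra ℂ A] [StarRing A]
    [StarModule ℂ A] [TopologicalSpace A] [IsTopologicalRing A] [ContinuousStar A] {x : A}
    {M : Submonoid A} (hx : x ∈ M) (hx' : star x ∈ M) :
    (StarAlgebra.elemental ℂ x : Set A) ⊆ closure (Submodule.span ℂ (M : Set A)) := by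
  refine closure_mono fun y hy => ?_
  have hy' : y ∈ Subalgebra.toSubmodule (Algebra.adjoin ℂ ({x} ∪ star {x})) := by
    rwa [← StarAlgebra.adjoin_toSubalgebra]
  rw [Algebra.adjoin_eq_span] at hy'
  refine Submodule.span_mono (Submonoid.closure_le.2 ?_) hy'
  rw [Set.star_singleton]
  exact Set.union_subset (Set.singleton_subset_iff.2 hx) (Set.singleton_subset_iff.2 hx')

lemma star_toeplitzShift_mul : star toeplitzShift * toeplitzShift = 1 :=
  Subtype.ext star_shift_mul_shift

lemma eq_top_of_monomial_mem {S : Submodule ℂ toeplitz} (hS : IsClosed (S : Set toeplitz))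
    (h : ∀ n m, monomial n m ∈ S) : S = ⊤ := by
  let M : Submonoid (Ell2 →L[ℂ] Ell2) :=
    (bicyclicSubmonoid star_toeplitzShift_mul).map toeplitz.subtype
  have shift_mem : shift ∈ M :=
    ⟨toeplitzShift, ⟨(1, 0), by simp only [pow_zero, pow_one, mul_one]⟩, rfl⟩
  have star_shift_mem : star shift ∈ M :=
    ⟨star toeplitzShift, ⟨(0, 1), by simp only [pow_zero, pow_one, one_mul]⟩, rfl⟩
  have span_le : Submodule.span ℂ (M : Set (Ell2 →L[ℂ] Ell2)) ≤
      S.map toeplitz.toSubalgebra.toSubmodule.subtype := by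
    refine Submodule.span_le.2 ?_
    rintro _ ⟨_, ⟨p, rfl⟩, rfl⟩
    exact ⟨_, h p.1 p.2, rfl⟩
  refine Submodule.eq_top_iff'.2 fun x => hS.closure_subset (closure_subtype.2 ?_)
  exact closure_mono span_le (elemental_subset_closure_span shift_mem star_shift_mem x.2)

lemma strongDual_ext {ρ φ : StrongDual ℂ toeplitz}
    (h : ∀ n m, ρ (monomial n m) = φ (monomial n m)) : ρ = φ := by
  have eqLocus_eq_top : LinearMap.eqLocus ρ.toLinearMap φ.toLinearMap = ⊤ :=
    eq_top_of_monomial_mem (isClosed_eq ρ.continuous φ.continuous) h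
  exact ContinuousLinearMap.coe_injective (LinearMap.eqLocus_eq_top.1 eqLocus_eq_top)

lemma monomial_zero_zero : monomial 0 0 = 1 := by
  rw [monomial, pow_zero, pow_zero, mul_one]

end Monomials

section Convolution

lemma tensorElem_mul (a a' b b' : toeplitz) :
    tensorElem a b * tensorElem a' b' = tensorElem (a * a') (b * b') :=
  Subtype.ext (opTensor_mul _ _ _ _)

lemma tensorElem_one : tensorElem 1 1 = 1 := Subtype.ext opTensor_one_one

lemma tensorElem_pow (a b : toeplitz) (k : ℕ) :
    tensorElem a b ^ k = tensorElem (a ^ k) (b ^ k) := by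
  induction k with
  | zero => rw [pow_zero, pow_zero, pow_zero, tensorElem_one]
  | succ k ih => rw [pow_succ, ih, tensorElem_mul, pow_succ, pow_succ]

lemma star_tensorElem (a b : toeplitz) : star (tensorElem a b) = tensorElem (star a) (star b) :=
  Subtype.ext (star_opTensor _ _)

lemma comul_monomial (n m : ℕ) :
    comul (monomial n m) = tensorElem (monomial n m) (monomial n m) := by
  rw [monomial, map_mul, map_pow, map_pow, map_star, comul_shift, star_tensorElem, tensorElem_pow,
    tensorElem_pow, tensorElem_mul]

lemma conv_monomial (ρ φ : StrongDual ℂ toeplitz) (n m : ℕ) :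
    conv ρ φ (monomial n m) = ρ (monomial n m) * φ (monomial n m) := by
  change tensorFunctional ρ φ (comul (monomial n m)) = _
  rw [comul_monomial, tensorFunctional_tensorElem]

lemma conv_comm (ρ φ : StrongDual ℂ toeplitz) : conv ρ φ = conv φ ρ :=
  strongDual_ext fun n m => by rw [conv_monomial, conv_monomial, mul_comm]

lemma conv_apply_one (ρ φ : StrongDual ℂ toeplitz) : conv ρ φ 1 = ρ 1 * φ 1 := by
  rw [← monomial_zero_zero, conv_monomial]

end Convolution

section HaarFunctional

lemma IsHaarFunctional.unique {V : Submodule ℂ (StrongDual ℂ toeplitz)}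
    {h h' : StrongDual ℂ toeplitz} (hh : IsHaarFunctional V h) (hh' : IsHaarFunctional V h') :
    h = h' := by
  have conv_eq {h h' : StrongDual ℂ toeplitz} (hh : IsHaarFunctional V h)
      (hh' : IsHaarFunctional V h') : conv h h' = h := by
    obtain ⟨c, hc, -⟩ := hh.invariant h' hh'.mem
    have hc_one : c = 1 := by
      simpa [conv_apply_one, hh.isState.2, hh'.isState.2] using (DFunLike.congr_fun hc 1).symm
    rw [hc, hc_one, one_smul]
  rw [← conv_eq hh hh', conv_comm, conv_eq hh' hh]

lemma isHaarFunctional_of_apply_monomial {V : Submodule ℂ (StrongDual ℂ toeplitz)}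
    {h : StrongDual ℂ toeplitz} (mem : h ∈ V) (isState : IsState h)
    (apply_eq : ∀ ρ ∈ V, ∀ n m, h (monomial n m) ≠ 0 → ρ (monomial n m) = ρ 1) :
    IsHaarFunctional V h := by
  refine ⟨mem, isState, fun ρ hρ => ?_⟩
  have conv_eq : conv h ρ = ρ 1 • h := strongDual_ext fun n m => by
    rw [conv_monomial, smul_apply, smul_eq_mul]
    obtain h0 | h0 := eq_or_ne (h (monomial n m)) 0
    · rw [h0, zero_mul, mul_zero]
    · rw [apply_eq ρ hρ n m h0, mul_comm]
  exact ⟨ρ 1, conv_eq, conv_comm ρ h ▸ conv_eq⟩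

end HaarFunctional

section CompactOperators

open Filter

variable {𝕜 E F G ι : Type*} [RCLike 𝕜] [NormedAddCommGroup E] [NormedSpace 𝕜 E]
  [NormedAddCommGroup F] [NormedSpace 𝕜 F] [NormedAddCommGroup G] [NormedSpace 𝕜 G]

lemma isCompactOperator_commutator_pow_right {S R : E →L[𝕜] E}
    (h : IsCompactOperator (S * R - R * S)) (n : ℕ) :
    IsCompactOperator (S * R ^ n - R ^ n * S) := by
  induction n with
  | zero =>
    rw [pow_zero, mul_one, one_mul, sub_self]
    exact isCompactOperator_zero
  | succ n ih =>
    have commutator_succ : S * R ^ (n + 1) - R ^ (n + 1) * S =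
        (S * R ^ n - R ^ n * S) * R + R ^ n * (S * R - R * S) := by
      rw [pow_succ]
      noncomm_ring
    rw [commutator_succ]
    exact (ih.comp_clm R).add (h.clm_comp (R ^ n))

lemma isCompactOperator_commutator_pow {S R : E →L[𝕜] E}
    (h : IsCompactOperator (S * R - R * S)) (n m : ℕ) :
    IsCompactOperator (S ^ n * R ^ m - R ^ m * S ^ n) := by
  have commutator_swap : IsCompactOperator (R ^ m * S - S * R ^ m) := by
    rw [← neg_sub]
    exact (isCompactOperator_commutator_pow_right h m).neg
  rw [← neg_sub]
  exact (isCompactOperator_commutator_pow_right commutator_swap n).neg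

lemma tendsto_apply_of_equicontinuous_of_span {S : ι → E →L[𝕜] F} {l : Filter ι}
    (hS : Equicontinuous fun i => (S i : E → F)) {s : Set E}
    (hs : (Submodule.span 𝕜 s).topologicalClosure = ⊤)
    (h : ∀ x ∈ s, Tendsto (fun i => S i x) l (𝓝 0)) (x : E) :
    Tendsto (fun i => S i x) l (𝓝 0) := by
  have span_subset : ∀ y ∈ Submodule.span 𝕜 s, Tendsto (fun i => S i y) l (𝓝 0) := by
    intro y hy
    induction hy using Submodule.span_induction with
    | mem y hy => exact h y hy
    | zero => simpa only [map_zero] using tendsto_const_nhds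
    | add y z _ _ hy hz => simpa only [map_add, add_zero] using hy.add hz
    | smul c y _ hy => simpa only [map_smul, smul_zero] using hy.const_smul c
  exact (hS.isClosed_setOfPred_tendsto continuous_const).closure_subset_iff.2 span_subset
    (hs.ge (Submodule.mem_top (x := x)))

lemma tendsto_norm_comp_of_isCompactOperator {S : ι → F →L[𝕜] G} {l : Filter ι}
    (hS : Equicontinuous fun i => (S i : F → G)) (h : ∀ y, Tendsto (fun i => S i y) l (𝓝 0))
    {K : E →L[𝕜] F} (hK : IsCompactOperator K) :
    Tendsto (fun i => ‖S i ∘L K‖) l (𝓝 0) := by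
  obtain ⟨C, hC, image_subset⟩ := hK.image_closedBall_subset_compact 1
  have tendstoUniformlyOn : TendstoUniformlyOn (fun i => (S i : F → G)) 0 l C := by
    have := (EquicontinuousOn.tendsto_uniformOnFun_iff_pi' (𝔖 := {C}) (by simpa using hC)
      (fun K _ => hS.equicontinuousOn K) l 0).2 (tendsto_pi_nhds.2 fun y => h y)
    exact UniformOnFun.tendsto_iff_tendstoUniformlyOn.1 this C rfl
  refine Metric.tendsto_nhds.2 fun ε hε => ?_
  filter_upwards [Metric.tendstoUniformlyOn_iff.1 tendstoUniformlyOn (ε / 2) (half_pos hε)]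
    with i hi
  rw [dist_zero_right, norm_norm]
  refine lt_of_le_of_lt (ContinuousLinearMap.opNorm_le_of_unit_norm (half_pos hε).le fun x hx => ?_)
    (half_lt_self hε)
  simpa using (hi (K x) (image_subset ⟨x, by simp [hx], rfl⟩)).le

end CompactOperators

section SymbolKernel

open Filter

lemma star_shift_stdBasis_zero : star shift (stdBasis 0) = 0 := by
  refine ext_inner_left ℂ fun v => ?_
  rw [ContinuousLinearMap.star_eq_adjoint, ContinuousLinearMap.adjoint_inner_right,
    inner_zero_right, stdBasis, lp.inner_single_right]
  exact inner_zero_left (𝕜 := ℂ) (1 : ℂ)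

lemma star_shift_stdBasis_succ (n : ℕ) : star shift (stdBasis (n + 1)) = stdBasis n := by
  rw [← shift_stdBasis]
  exact DFunLike.congr_fun star_shift_mul_shift (stdBasis n)

lemma star_shift_pow_stdBasis {n k : ℕ} (h : k < n) : (star shift ^ n) (stdBasis k) = 0 := by
  induction k generalizing n with
  | zero =>
    obtain ⟨n, rfl⟩ := Nat.exists_eq_add_of_le' h
    rw [pow_succ, mul_apply_eq_comp, star_shift_stdBasis_zero, map_zero]
  | succ k ih =>
    obtain ⟨n, rfl⟩ := Nat.exists_eq_add_of_le' (Nat.one_le_of_lt h)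
    rw [pow_succ, mul_apply_eq_comp, star_shift_stdBasis_succ, ih (Nat.lt_of_succ_lt_succ h)]

lemma norm_star_shift_le : ‖(star shift : Ell2 →L[ℂ] Ell2)‖ ≤ 1 := by
  rw [ContinuousLinearMap.star_eq_adjoint, LinearIsometryEquiv.norm_map]
  exact shiftIsometry.norm_toContinuousLinearMap_le

lemma norm_star_shift_pow_le (n : ℕ) : ‖(star shift ^ n : Ell2 →L[ℂ] Ell2)‖ ≤ 1 := by
  induction n with
  | zero => exact ContinuousLinearMap.norm_id_le
  | succ n ih =>
    rw [pow_succ]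
    exact (norm_mul_le _ _).trans (mul_le_one₀ ih (norm_nonneg _) norm_star_shift_le)

lemma equicontinuous_star_shift_pow :
    Equicontinuous fun n : ℕ => (⇑(star shift ^ n : Ell2 →L[ℂ] Ell2) : Ell2 → Ell2) :=
  (LipschitzWith.uniformEquicontinuous _ 1 fun n =>
    (star shift ^ n : Ell2 →L[ℂ] Ell2).lipschitz.weaken (norm_star_shift_pow_le n)).equicontinuous

lemma tendsto_star_shift_pow_apply (x : Ell2) :
    Tendsto (fun n : ℕ => (star shift ^ n) x) atTop (𝓝 0) := by
  refine tendsto_apply_of_equicontinuous_of_span equicontinuous_star_shift_pow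
    closure_span_stdBasis ?_ x
  rintro _ ⟨k, rfl⟩
  refine tendsto_const_nhds.congr' ?_
  filter_upwards [eventually_gt_atTop k] with n hn using (star_shift_pow_stdBasis hn).symm

lemma norm_symbol_apply_le (A : toeplitz) : ‖symbol A‖ ≤ ‖A‖ := by
  simpa only [mul_one] using NonUnitalStarAlgHom.norm_apply_le symbol A

-- `γ(T*)` is unimodular, so `A` may be replaced by `(T*)ⁿ A`, whose norm tends to zero.
lemma symbol_eq_zero_of_isCompactOperator {A : toeplitz}
    (hA : IsCompactOperator (A : Ell2 →L[ℂ] Ell2)) : symbol A = 0 := by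
  have norm_le (z : Circle) (n : ℕ) :
      ‖symbol A z‖ ≤ ‖(star shift ^ n) ∘L (A : Ell2 →L[ℂ] Ell2)‖ :=
    calc ‖symbol A z‖ = ‖(z : ℂ) ^ n * symbol A z‖ := by
          rw [norm_mul, norm_pow, Circle.norm_coe, one_pow, one_mul]
      _ = ‖symbol (star toeplitzShift ^ n * A) z‖ := by
          rw [map_mul, map_pow, map_star, symbol_shift, star_star]
          rfl
      _ ≤ ‖symbol (star toeplitzShift ^ n * A)‖ := ContinuousMap.norm_coe_le_norm _ z
      _ ≤ ‖star toeplitzShift ^ n * A‖ := norm_symbol_apply_le _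
  ext z
  exact norm_le_zero_iff.1 (ge_of_tendsto' (tendsto_norm_comp_of_isCompactOperator
    equicontinuous_star_shift_pow tendsto_star_shift_pow_apply hA) (norm_le z))

end SymbolKernel

section Compression

variable {E H : Type*} [NormedAddCommGroup E] [InnerProductSpace ℂ E] [CompleteSpace E]
  [NormedAddCommGroup H] [InnerProductSpace ℂ H] [CompleteSpace H]

/-- The compression `B ↦ V* B V` of operators along a bounded map `V`, usually an isometry. -/
def compression (V : E →L[ℂ] H) : (H →L[ℂ] H) →L[ℂ] (E →L[ℂ] E) :=
  (ContinuousLinearMap.compL ℂ E H E V.adjoint) ∘L (ContinuousLinearMap.compL ℂ E H H).flip V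

lemma compression_apply (V : E →L[ℂ] H) (B : H →L[ℂ] H) :
    compression V B = V.adjoint ∘L B ∘L V := rfl

lemma compression_one (V : E →ₗᵢ[ℂ] H) : compression V.toContinuousLinearMap 1 = 1 :=
  (ContinuousLinearMap.norm_map_iff_adjoint_comp_self _).1 V.norm_map

variable {V : E →L[ℂ] H} {U : H →L[ℂ] H} {S : E →L[ℂ] E}

lemma compression_mul_of_intertwines (h : U ∘L V = V ∘L S) (B : H →L[ℂ] H) :
    compression V (B * U) = compression V B * S := by
  simp only [compression_apply, ContinuousLinearMap.mul_def, ContinuousLinearMap.comp_assoc, h]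

lemma compression_star_mul_of_intertwines (h : U ∘L V = V ∘L S) (B : H →L[ℂ] H) :
    compression V (star U * B) = star S * compression V B := by
  have adjoint_intertwines : V.adjoint ∘L U.adjoint = S.adjoint ∘L V.adjoint := by
    rw [← ContinuousLinearMap.adjoint_comp, h, ContinuousLinearMap.adjoint_comp]
  rw [compression_apply, compression_apply, ContinuousLinearMap.star_eq_adjoint,
    ContinuousLinearMap.star_eq_adjoint, ContinuousLinearMap.mul_def, ContinuousLinearMap.mul_def,
    ContinuousLinearMap.comp_assoc, ← ContinuousLinearMap.comp_assoc, adjoint_intertwines,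
    ContinuousLinearMap.comp_assoc]

end Compression

section EllTwoMap

variable {ι κ : Type*} [DecidableEq κ]

lemma orthonormal_single :
    Orthonormal ℂ fun k : κ => (lp.single 2 k 1 : lp (fun _ : κ => ℂ) 2) := by
  refine orthonormal_iff_ite.2 fun i j => ?_
  simp [lp.inner_single_left, Pi.single_apply]

/-- The isometry `ℓ²(ι) → ℓ²(κ)` sending `e_i` to `e_{f i}` for an injection `f`. -/
def ellTwoMap (f : ι ↪ κ) : lp (fun _ : ι => ℂ) 2 →ₗᵢ[ℂ] lp (fun _ : κ => ℂ) 2 :=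
  (orthonormal_single.comp f f.injective).orthogonalFamily.linearIsometry

lemma ellTwoMap_single [DecidableEq ι] (f : ι ↪ κ) (i : ι) :
    ellTwoMap f (lp.single 2 i 1) = lp.single 2 (f i) 1 :=
  ((orthonormal_single.comp f f.injective).orthogonalFamily.linearIsometry_apply_single
    (i := i) (1 : ℂ)).trans (one_smul ℂ _)

end EllTwoMap

section Dilation

/-- The space `ℓ²(ℤ)` of the bilateral shift. -/
abbrev Ell2Int : Type := lp (fun _ : ℤ => ℂ) 2

/-- The inclusion of `ℓ²(ℤ₊)` in `ℓ²(ℤ)`. -/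
def inclusion : Ell2 →ₗᵢ[ℂ] Ell2Int := ellTwoMap Nat.castEmbedding

/-- The translation `e_d ↦ e_{d+k}` of `ℓ²(ℤ)`. -/
def translation (k : ℤ) : Ell2Int →L[ℂ] Ell2Int :=
  (ellTwoMap (Equiv.addRight k).toEmbedding).toContinuousLinearMap

lemma translation_single (k d : ℤ) :
    translation k (lp.single 2 d 1) = lp.single 2 (d + k) (1 : ℂ) :=
  ellTwoMap_single _ d

lemma translation_mul_translation_neg (k : ℤ) : translation k * translation (-k) = 1 := by
  refine ContinuousLinearMap.ext_on
    (Submodule.dense_iff_topologicalClosure_eq_top.2 closure_span_single) ?_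
  rintro _ ⟨d, rfl⟩
  rw [mul_apply_eq_comp, translation_single, translation_single, neg_add_cancel_right]
  rfl

lemma translation_mem_unitary (k : ℤ) : translation k ∈ unitary (Ell2Int →L[ℂ] Ell2Int) := by
  have star_mul : star (translation k) * translation k = 1 :=
    (ContinuousLinearMap.norm_map_iff_adjoint_comp_self _).1 (ellTwoMap _).norm_map
  refine Unitary.mem_iff.2 ⟨star_mul, ?_⟩
  rw [left_inv_eq_right_inv star_mul (translation_mul_translation_neg k),
    translation_mul_translation_neg]

lemma translation_comp_inclusion :
    translation 1 ∘L inclusion.toContinuousLinearMap =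
      inclusion.toContinuousLinearMap ∘L shift := by
  refine ContinuousLinearMap.ext_on
    (Submodule.dense_iff_topologicalClosure_eq_top.2 closure_span_stdBasis) ?_
  rintro _ ⟨n, rfl⟩
  change translation 1 (inclusion (stdBasis n)) = inclusion (shift (stdBasis n))
  rw [shift_stdBasis, inclusion, stdBasis, stdBasis, ellTwoMap_single, ellTwoMap_single,
    translation_single]
  rfl

end Dilation

section ToeplitzOperator

/-- The continuous functional calculus of a unitary element, on the whole circle rather than on
the spectrum. -/
def circleHom {B : Type*} [CStarAlgebra B] (u : unitary B) : C(Circle, ℂ) →⋆ₐ[ℂ] B :=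
  have isStarNormal : IsStarNormal (u : B) := isStarNormal_of_mem_unitary u.2
  (cfcHom isStarNormal).comp (ContinuousMap.compStarAlgHom' ℂ ℂ
    ⟨fun x : spectrum ℂ (u : B) => ⟨x, spectrum.subset_circle_of_unitary u.2 x.2⟩, by fun_prop⟩)

lemma circleHom_circleVar {B : Type*} [CStarAlgebra B] (u : unitary B) :
    circleHom u circleVar = u :=
  cfcHom_id (isStarNormal_of_mem_unitary u.2)

/-- The representation of `C(S¹)` on `ℓ²(ℤ)` in which `e^{iθ}` acts as the backward bilateral
shift; this direction matches the convention `γ(T) = e^{-iθ}`. -/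
def bilateralHom : C(Circle, ℂ) →⋆ₐ[ℂ] (Ell2Int →L[ℂ] Ell2Int) :=
  circleHom (star ⟨translation 1, translation_mem_unitary 1⟩)

lemma bilateralHom_circleVar : bilateralHom circleVar = star (translation 1) :=
  circleHom_circleVar _

/-- The Toeplitz operator with a continuous symbol. -/
def toeplitzOperator : C(Circle, ℂ) →L[ℂ] (Ell2 →L[ℂ] Ell2) :=
  compression inclusion.toContinuousLinearMap ∘L
    { toLinearMap := bilateralHom.toAlgHom.toLinearMap
      cont := map_continuous bilateralHom }

lemma toeplitzOperator_apply (f : C(Circle, ℂ)) :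
    toeplitzOperator f = compression inclusion.toContinuousLinearMap (bilateralHom f) := rfl

lemma toeplitzOperator_one : toeplitzOperator 1 = 1 := by
  rw [toeplitzOperator_apply, map_one, compression_one]

lemma toeplitzOperator_mul_star_circleVar (f : C(Circle, ℂ)) :
    toeplitzOperator (f * star circleVar) = toeplitzOperator f * shift := by
  rw [toeplitzOperator_apply, map_mul, map_star, bilateralHom_circleVar, star_star,
    compression_mul_of_intertwines translation_comp_inclusion, toeplitzOperator_apply]

lemma toeplitzOperator_circleVar_mul (f : C(Circle, ℂ)) :
    toeplitzOperator (circleVar * f) = star shift * toeplitzOperator f := by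
  rw [toeplitzOperator_apply, map_mul, bilateralHom_circleVar,
    compression_star_mul_of_intertwines translation_comp_inclusion, toeplitzOperator_apply]

lemma toeplitzOperator_star_circleVar_pow (n : ℕ) :
    toeplitzOperator (star circleVar ^ n) = shift ^ n := by
  induction n with
  | zero => rw [pow_zero, pow_zero, toeplitzOperator_one]
  | succ n ih => rw [pow_succ, toeplitzOperator_mul_star_circleVar, ih, pow_succ]

lemma toeplitzOperator_symbol_monomial (n m : ℕ) :
    toeplitzOperator (symbol (monomial n m)) = star shift ^ m * shift ^ n := by
  rw [monomial, map_mul, map_pow, map_pow, map_star, symbol_shift, star_star, mul_comm]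
  induction m with
  | zero => rw [pow_zero, pow_zero, one_mul, one_mul, toeplitzOperator_star_circleVar_pow]
  | succ m ih =>
    rw [pow_succ', mul_assoc, toeplitzOperator_circleVar_mul, ih, pow_succ', mul_assoc]

lemma isCompactOperator_one_sub_shift :
    IsCompactOperator (1 - shift * star shift : Ell2 →L[ℂ] Ell2) := by
  have eq_rankOne : (1 - shift * star shift : Ell2 →L[ℂ] Ell2) =
      ContinuousLinearMap.toSpanSingleton ℂ (stdBasis 0) ∘L innerSL ℂ (stdBasis 0) := by
    refine ContinuousLinearMap.ext_on
      (Submodule.dense_iff_topologicalClosure_eq_top.2 closure_span_stdBasis) ?_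
    rintro _ ⟨n, rfl⟩
    have inner_stdBasis := orthonormal_iff_ite.1 orthonormal_stdBasis 0 n
    cases n with
    | zero => simp [star_shift_stdBasis_zero, orthonormal_stdBasis.1,
        ContinuousLinearMap.toSpanSingleton_apply]
    | succ n => simp [star_shift_stdBasis_succ, inner_stdBasis, shift_stdBasis,
        ContinuousLinearMap.toSpanSingleton_apply]
  rw [eq_rankOne]
  exact (isCompactOperator_of_locallyCompactSpace_rng (ContinuousLinearMap.toSpanSingleton ℂ
    (stdBasis 0))).comp_clm (innerSL ℂ (stdBasis 0))

lemma isCompactOperator_monomial_sub_toeplitzOperator (n m : ℕ) : IsCompactOperator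
    ((monomial n m : Ell2 →L[ℂ] Ell2) - toeplitzOperator (symbol (monomial n m))) := by
  have commutator : IsCompactOperator (shift * star shift - star shift * shift) := by
    rw [star_shift_mul_shift, ← neg_sub]
    exact isCompactOperator_one_sub_shift.neg
  rw [toeplitzOperator_symbol_monomial]
  exact isCompactOperator_commutator_pow commutator n m

lemma isCompactOperator_sub_toeplitzOperator (A : toeplitz) :
    IsCompactOperator ((A : Ell2 →L[ℂ] Ell2) - toeplitzOperator (symbol A)) := by
  let remainder : toeplitz →L[ℂ] (Ell2 →L[ℂ] Ell2) :=
    toeplitz.toSubalgebra.toSubmodule.subtypeL - toeplitzOperator ∘L symbolL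
  have comap_eq_top :
      (compactOperator (RingHom.id ℂ) Ell2 Ell2).comap remainder.toLinearMap = ⊤ :=
    eq_top_of_monomial_mem (isClosed_setOfPred_isCompactOperator.preimage remainder.continuous)
      isCompactOperator_monomial_sub_toeplitzOperator
  exact Submodule.eq_top_iff'.1 comap_eq_top A

lemma denseRange_symbol : DenseRange symbol := by
  have closure_eq_top :=
    ContinuousMap.starSubalgebra_topologicalClosure_eq_top_of_separatesPoints symbol.range
      fun z w hzw => by
        refine ⟨_, ⟨star circleVar, ⟨toeplitzShift, symbol_shift⟩, rfl⟩, fun h => hzw ?_⟩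
        exact Circle.ext (star_injective h)
  exact fun f => closure_eq_top.ge (StarSubalgebra.mem_top (x := f))

lemma toeplitzOperator_symbol_mem (A : toeplitz) : toeplitzOperator (symbol A) ∈ toeplitz := by
  have comap_eq_top : toeplitz.toSubalgebra.toSubmodule.comap
      (toeplitzOperator ∘L symbolL).toLinearMap = ⊤ := by
    refine eq_top_of_monomial_mem ((StarAlgebra.elemental.isClosed ℂ shift).preimage
      (toeplitzOperator ∘L symbolL).continuous) fun n m => ?_
    change toeplitzOperator (symbol (monomial n m)) ∈ toeplitz
    rw [toeplitzOperator_symbol_monomial]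
    exact (star toeplitzShift ^ m * toeplitzShift ^ n).2
  exact Submodule.eq_top_iff'.1 comap_eq_top A

lemma toeplitzOperator_mem (f : C(Circle, ℂ)) : toeplitzOperator f ∈ toeplitz := by
  refine denseRange_symbol.induction_on f ?_ toeplitzOperator_symbol_mem
  exact (StarAlgebra.elemental.isClosed ℂ shift).preimage toeplitzOperator.continuous

/-- The bounded linear section of the symbol map that sends a continuous function to its Toeplitz
operator. -/
def symbolSection : C(Circle, ℂ) →L[ℂ] toeplitz :=
  toeplitzOperator.codRestrict toeplitz.toSubalgebra.toSubmodule toeplitzOperator_mem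

lemma eq_comp_symbolL_of_mem_compactAnnihilator {ρ : StrongDual ℂ toeplitz}
    (hρ : ρ ∈ compactAnnihilator) : ρ = (ρ ∘L symbolSection) ∘L symbolL := by
  ext A
  have apply_sub : ρ (A - symbolSection (symbol A)) = 0 :=
    hρ _ (isCompactOperator_sub_toeplitzOperator A)
  rw [ContinuousLinearMap.map_sub] at apply_sub
  exact sub_eq_zero.1 apply_sub

end ToeplitzOperator

section MeasureFunctional

lemma range_measureFunctional : LinearMap.range measureFunctional = compactAnnihilator := by
  refine le_antisymm ?_ fun ρ hρ => ?_
  · rintro _ ⟨μ, rfl⟩ A hA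
    change integralFunctional μ (symbol A) = 0
    rw [symbol_eq_zero_of_isCompactOperator hA, map_zero]
  · obtain ⟨μ, hμ⟩ := integralFunctional_surjective (ρ ∘L symbolSection)
    refine ⟨μ, ?_⟩
    rw [eq_comp_symbolL_of_mem_compactAnnihilator hρ, ← hμ]
    rfl

lemma measureFunctional_mem_compactAnnihilator (μ : CircleMeasure) :
    measureFunctional μ ∈ compactAnnihilator :=
  range_measureFunctional.le ⟨μ, rfl⟩

lemma measureFunctional_injective : Function.Injective measureFunctional := by
  refine fun μ ν h => integralFunctional_injective (DFunLike.coe_injective ?_)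
  refine denseRange_symbol.equalizer (integralFunctional μ).continuous
    (integralFunctional ν).continuous (funext fun A => ?_)
  exact DFunLike.congr_fun h A

lemma measureFunctional_measureConv (μ ν : CircleMeasure) :
    measureFunctional (measureConv μ ν) = conv (measureFunctional μ) (measureFunctional ν) := by
  refine strongDual_ext fun n m => ?_
  have symbol_mul (z w : Circle) :
      symbol (monomial n m) (z * w) = symbol (monomial n m) z * symbol (monomial n m) w := by
    rw [symbol_monomial, symbol_monomial, symbol_monomial, Circle.coe_mul, mul_zpow]
  rw [conv_monomial]
  exact integralFunctional_measureConv _ symbol_mul μ ν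

lemma conv_mem_compactAnnihilator {ρ φ : StrongDual ℂ toeplitz} (hρ : ρ ∈ compactAnnihilator)
    (hφ : φ ∈ compactAnnihilator) : conv ρ φ ∈ compactAnnihilator := by
  obtain ⟨μ, rfl⟩ := range_measureFunctional.ge hρ
  obtain ⟨ν, rfl⟩ := range_measureFunctional.ge hφ
  rw [← measureFunctional_measureConv]
  exact measureFunctional_mem_compactAnnihilator _

end MeasureFunctional

section HaarMeasure

lemma isState_measureFunctional_ofMeasure (m : Measure Circle) [IsProbabilityMeasure m] :
    IsState (measureFunctional (ofMeasure m)) := by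
  refine ⟨fun A => ?_, ?_⟩
  · have star_mul_self (z : Circle) : symbol (star A * A) z = ((‖symbol A z‖ ^ 2 : ℝ) : ℂ) := by
      rw [map_mul, map_star, Complex.ofReal_pow]
      exact Complex.conj_mul' _
    rw [measureFunctional_apply, cintegral_ofMeasure]
    simp only [star_mul_self]
    rw [integral_complex_ofReal, Complex.zero_le_real]
    exact integral_nonneg fun z => sq_nonneg _
  · rw [measureFunctional_apply, cintegral_ofMeasure, map_one]
    simp only [ContinuousMap.one_apply, integral_const, probReal_univ, one_smul]

instance isProbabilityMeasure_haarMeasure_circle :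
    IsProbabilityMeasure (Measure.haarMeasure (⊤ : TopologicalSpace.PositiveCompacts Circle)) :=
  ⟨Measure.haarMeasure_self⟩

-- Translation by `exp (iπ / k)` changes the sign of `z ↦ z ^ k`.
lemma integral_zpow_eq_zero (m : Measure Circle) [m.IsMulLeftInvariant] {k : ℤ} (hk : k ≠ 0) :
    ∫ z : Circle, (z : ℂ) ^ k ∂m = 0 := by
  have exp_zpow : (Circle.exp (Real.pi / k) : ℂ) ^ k = -1 := by
    have : (k : ℂ) ≠ 0 := Int.cast_ne_zero.2 hk
    rw [Circle.coe_exp, ← Complex.exp_int_mul, ← Complex.exp_pi_mul_I]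
    congr 1
    push_cast
    field_simp
  refine integral_eq_zero_of_mul_left_eq_neg (g := Circle.exp (Real.pi / k)) fun z => ?_
  rw [Circle.coe_mul, mul_zpow, exp_zpow, neg_one_mul]

lemma measureFunctional_haarCircle_monomial (n m : ℕ) :
    measureFunctional haarCircle (monomial n m) = if n = m then 1 else 0 := by
  have eq_integral : measureFunctional haarCircle (monomial n m) = ∫ z : Circle,
      (z : ℂ) ^ ((m : ℤ) - n) ∂Measure.haarMeasure (⊤ : TopologicalSpace.PositiveCompacts Circle) :=
    (cintegral_ofMeasure _ _).trans (integral_congr_ae (.of_forall (symbol_monomial n m)))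
  rw [eq_integral]
  split_ifs with h
  · simp only [h, sub_self, zpow_zero, integral_const, probReal_univ, one_smul]
  · exact integral_zpow_eq_zero _ (by lia)

lemma symbol_monomial_self (n : ℕ) : symbol (monomial n n) = 1 := by
  ext z
  rw [symbol_monomial, sub_self, zpow_zero, ContinuousMap.one_apply]

lemma apply_monomial_self_of_mem_compactAnnihilator {ρ : StrongDual ℂ toeplitz}
    (hρ : ρ ∈ compactAnnihilator) (n : ℕ) : ρ (monomial n n) = ρ 1 := by
  obtain ⟨μ, rfl⟩ := range_measureFunctional.ge hρ
  rw [measureFunctional_apply, measureFunctional_apply, symbol_monomial_self, map_one]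

lemma isHaarFunctional_haarCircle :
    IsHaarFunctional compactAnnihilator (measureFunctional haarCircle) := by
  refine isHaarFunctional_of_apply_monomial (measureFunctional_mem_compactAnnihilator _)
    (isState_measureFunctional_ofMeasure _) fun ρ hρ n m h => ?_
  rw [measureFunctional_haarCircle_monomial] at h
  obtain rfl : n = m := of_not_not fun hnm => h (if_neg hnm)
  exact apply_monomial_self_of_mem_compactAnnihilator hρ n

end HaarMeasure

section VacuumState

/-- The functional `A ↦ ⟪x, A x⟫` of a vector `x`; it is a state when `x` is a unit vector. -/
def vectorFunctional (x : Ell2) : StrongDual ℂ toeplitz :=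
  innerSL ℂ x ∘L ContinuousLinearMap.apply ℂ Ell2 x ∘L toeplitz.toSubalgebra.toSubmodule.subtypeL

lemma isState_vectorFunctional {x : Ell2} (hx : ‖x‖ = 1) : IsState (vectorFunctional x) := by
  refine ⟨fun A => ?_, ?_⟩
  · have star_mul_self : vectorFunctional x (star A * A) =
        inner ℂ ((A : Ell2 →L[ℂ] Ell2) x) ((A : Ell2 →L[ℂ] Ell2) x) :=
      ContinuousLinearMap.adjoint_inner_right (A : Ell2 →L[ℂ] Ell2) _ _
    rw [star_mul_self, inner_self_eq_norm_sq_to_K]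
    exact pow_nonneg (Complex.zero_le_real.2 (norm_nonneg ((A : Ell2 →L[ℂ] Ell2) x))) 2
  · exact (inner_self_eq_norm_sq_to_K x).trans (by rw [hx]; norm_num)

lemma vectorFunctional_stdBasis_zero_monomial {n m : ℕ} (h : (n, m) ≠ (0, 0)) :
    vectorFunctional (stdBasis 0) (monomial n m) = 0 := by
  have eq_inner : vectorFunctional (stdBasis 0) (monomial n m) =
      inner ℂ ((star shift ^ n : Ell2 →L[ℂ] Ell2) (stdBasis 0))
        ((star shift ^ m : Ell2 →L[ℂ] Ell2) (stdBasis 0)) := by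
    rw [← star_pow shift n]
    exact (ContinuousLinearMap.adjoint_inner_left (shift ^ n) _ _).symm
  rw [eq_inner]
  obtain rfl | hm := m.eq_zero_or_pos
  · have hn : 0 < n := Nat.pos_of_ne_zero fun hn => h (by rw [hn])
    rw [star_shift_pow_stdBasis hn, inner_zero_left]
  · rw [star_shift_pow_stdBasis hm, inner_zero_right]

lemma isHaarFunctional_vectorFunctional_stdBasis_zero :
    IsHaarFunctional ⊤ (vectorFunctional (stdBasis 0)) := by
  refine isHaarFunctional_of_apply_monomial Submodule.mem_top
    (isState_vectorFunctional (orthonormal_stdBasis.1 0)) fun ρ _ n m h => ?_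
  obtain ⟨rfl, rfl⟩ : n = 0 ∧ m = 0 := Prod.mk.inj
    (of_not_not fun hnm => h (vectorFunctional_stdBasis_zero_monomial hnm))
  rw [monomial_zero_zero]

lemma measureFunctional_haarCircle_ne_vectorFunctional :
    measureFunctional haarCircle ≠ vectorFunctional (stdBasis 0) := fun h => by
  refine one_ne_zero (α := ℂ) ?_
  calc 1 = measureFunctional haarCircle (monomial 1 1) := by
        rw [measureFunctional_haarCircle_monomial, if_pos rfl]
    _ = 0 := by rw [h, vectorFunctional_stdBasis_zero_monomial (by simp)]

end VacuumState

end

end ToeplitzQS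

theorem theorem10 :
    -- the annihilator of the compact operators is a subalgebra of the dual algebra
    (∀ ρ ∈ ToeplitzQS.compactAnnihilator, ∀ φ ∈ ToeplitzQS.compactAnnihilator,
      ToeplitzQS.conv ρ φ ∈ ToeplitzQS.compactAnnihilator) ∧
    -- integration of symbols is an algebra isomorphism from `M(S¹)` onto this subalgebra
    (Function.Injective ToeplitzQS.measureFunctional ∧
      LinearMap.range ToeplitzQS.measureFunctional = ToeplitzQS.compactAnnihilator ∧
      ∀ μ ν : ToeplitzQS.CircleMeasure,
        ToeplitzQS.measureFunctional (ToeplitzQS.measureConv μ ν) =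
          ToeplitzQS.conv (ToeplitzQS.measureFunctional μ) (ToeplitzQS.measureFunctional ν)) ∧
    ∃ h₀ : StrongDual ℂ ToeplitzQS.toeplitz,
      -- `h₀` is the unique Haar functional in the subalgebra
      ToeplitzQS.IsHaarFunctional ToeplitzQS.compactAnnihilator h₀ ∧
      (∀ h', ToeplitzQS.IsHaarFunctional ToeplitzQS.compactAnnihilator h' → h' = h₀) ∧
      (∀ n m : ℕ, h₀ (ToeplitzQS.monomial n m) = if n = m then 1 else 0) ∧
      -- it differs from the unique Haar functional in the whole dual algebra
      (∃ h : StrongDual ℂ ToeplitzQS.toeplitz,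
        ToeplitzQS.IsHaarFunctional ⊤ h ∧
        (∀ h', ToeplitzQS.IsHaarFunctional ⊤ h' → h' = h) ∧
        h₀ ≠ h) ∧
      -- it corresponds to normalized Haar measure under the isomorphism
      ToeplitzQS.measureFunctional ToeplitzQS.haarCircle = h₀ := by
  refine ⟨fun ρ hρ φ hφ => ToeplitzQS.conv_mem_compactAnnihilator hρ hφ,
    ⟨ToeplitzQS.measureFunctional_injective, ToeplitzQS.range_measureFunctional,
      ToeplitzQS.measureFunctional_measureConv⟩,
    ToeplitzQS.measureFunctional ToeplitzQS.haarCircle, ToeplitzQS.isHaarFunctional_haarCircle,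
    fun h' hh' => hh'.unique ToeplitzQS.isHaarFunctional_haarCircle,
    ToeplitzQS.measureFunctional_haarCircle_monomial, ?_, rfl⟩
  exact ⟨ToeplitzQS.vectorFunctional (ToeplitzQS.stdBasis 0),
    ToeplitzQS.isHaarFunctional_vectorFunctional_stdBasis_zero,
    fun h' hh' => hh'.unique ToeplitzQS.isHaarFunctional_vectorFunctional_stdBasis_zero,
    ToeplitzQS.measureFunctional_haarCircle_ne_vectorFunctional⟩
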